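/- For $r\ge 1$ let $\zeta_r(s_1,\dots,s_r)=\sum_{0<m_1<\cdots<m_r} m_1^{-s_1}\cdots m_r^{-s_r}$ be the Euler–Zagier multiple zeta function, which converges absolutely for $\Re(s_{r-k+1}+\cdots+s_r)>k$ $(1\le k\le r)$, and set $\zeta_0:=1$. It extends holomorphically to the complement in $\mathbb C^r$ of the set of singularities $$s_r=1;\qquad s_{r-1}+s_r\in\{2,1,0,-2,-4,-6,\dots\};\qquad s_{r-k+1}+\cdots+s_r\in\mathbb Z_{\le k}\quad(3\le k\le r),$$ where a condition is imposed only if the variables in it exist; the extension is again denoted by $\zeta_r$. An index $\mathbf n=(n_1,\dots,n_r)\in\mathbb Z^r$ is called regular if it is not in this set. An index $\mathbf m=(m_1,\dots,m_l)$ of positive integers is admissible if $l=0$ or $m_l>1$; the values $\zeta(\mathbf m)=\zeta_l(m_1,\dots,m_l)$ at admissible indices, with $\zeta(\emptyset)=1$, are the multiple zeta values. Let $Z^{\le a}_{\le b}\subset\mathbb R$ be the $\mathbb Q$-span of the $\zeta(\mathbf m)$ with $\mathbf m$ admissible of depth (length) $\le a$ and weight (sum of entries) $\le b$. Let $\mathbf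 n\in\mathbb Z^r$ be regular, and let $d$ and $w$ be the number and the sum of the positive entries of $\mathbf n$. (1) Suppose that the $j$-th entry of $\mathbf n$ is $-m$ with $m\ge0$, and let $\delta$ be the Kronecker delta. If $r\ge2$, then $$\begin{aligned}\zeta_r(\mathbf n)={}&(1-\delta_{j1})\Big[-\tfrac1{m+1}\zeta_{r-1}(\dots,n_{j-1}-m-1,n_{j+1},\dots)+\sum_{k=0}^{m}\tbinom mk\zeta(-k)\,\zeta_{r-1}(\dots,n_{j-1}-m+k,n_{j+1},\dots)\Big]\\&-(1-\delta_{jr})\Big[-\tfrac1{m+1}\zeta_{r-1}(\dots,n_{j-1},n_{j+1}-m-1,\dots)+\sum_{k=0}^{m}\tbinom mk\zeta(-k)\,\zeta_{r-1}(\dots,n_{j-1},n_{j+1}-m+k,\dots)\Big]\\&+\delta_{j1}\,\zeta(-m)\,\zeta_{r-1}(n_2,\dots,n_r)-(1-\delta_{jr})\,\zeta_{r-1}(\dots,n_{j-1},n_{j+1}-m,\dots),\end{aligned}$$ where $\zeta(-k)\in\mathbb Q$, terms with total coefficient $0$ are omitted, and all remaining indices on the right are regular. If $r=1$, then $\zeta_1(-m)=\zeta(-m)\in\mathbb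 Q$. (2) By finitely many applications of (1), $\zeta_r(\mathbf n)$ is expressed as a rational linear combination of multiple zeta values $\zeta(\mathbf m)$, each of depth $\le d$ and weight $\le w$. In particular $$\zeta_r(n_1,\dots,n_r)\in Z^{\le d}_{\le w}.$$ -/

import Mathlib

noncomputable section

namespace EulerZagier

/-- The summation range `0 < x₁ < x₂ < ⋯ < x_r` of integers. -/
abbrev Chain (r : ℕ) : Type :=
  {x : Fin r → ℕ // StrictMono x ∧ ∀ i, 0 < x i}

/-- The sum `s_{r-k+1} + ⋯ + s_r` of the last `k` coordinates. -/
def tailSum {r : ℕ} (s : Fin r → ℂ) (k : ℕ) : ℂ :=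
  ∑ i : Fin r, if r ≤ (i : ℕ) + k then s i else 0

/-- The region of absolute convergence
`Re s_r > 1, Re (s_{r-1} + s_r) > 2, …, Re (s_1 + ⋯ + s_r) > r`. -/
def convergenceRegion (r : ℕ) : Set (Fin r → ℂ) :=
  {s | ∀ k : ℕ, 1 ≤ k → k ≤ r → (k : ℝ) < (tailSum s k).re}

/-- The set of singularities:
`s_r = 1`; `s_{r-1} + s_r = 2, 1, 0, -2, -4, …`; and, for `3 ≤ k ≤ r`,
`s_{r-k+1} + ⋯ + s_r` an integer `≤ k`. -/
def singularSet (r : ℕ) : Set (Fin r → ℂ) :=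
  {s | (1 ≤ r ∧ tailSum s 1 = 1) ∨
    (2 ≤ r ∧ (tailSum s 2 = 2 ∨ tailSum s 2 = 1 ∨ ∃ j : ℕ, tailSum s 2 = -2 * (j : ℂ))) ∨
    ∃ k : ℕ, 3 ≤ k ∧ k ≤ r ∧ ∃ z : ℤ, z ≤ (k : ℤ) ∧ tailSum s k = (z : ℂ)}

/-- `f` is the Euler–Zagier multiple zeta function of depth `r`: it is holomorphic off the set of
singularities and is given by the (unconditionally convergent) defining series
in the region of convergence. -/
def IsMultipleZetaFunction (r : ℕ) (f : (Fin r → ℂ) → ℂ) : Prop :=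
  DifferentiableOn ℂ f (singularSet r)ᶜ ∧
    ∀ s ∈ convergenceRegion r,
      HasSum (fun x : Chain r => ∏ i, (x.1 i : ℂ) ^ (-(s i))) (f s)

/-- An integer index `(n_1, …, n_r)` as a point of `ℂ^r`. -/
def toPoint (n : List ℤ) : Fin n.length → ℂ := fun i => (n.get i : ℂ)

/-- The index is not on the set of singularities. -/
def IsRegularIndex (n : List ℤ) : Prop := toPoint n ∉ singularSet n.length

/-- The value `ζ_r(n_1, …, n_r)` for a family `F` of functions, one for each depth. -/
def valueAt (F : (r : ℕ) → (Fin r → ℂ) → ℂ) (n : List ℤ) : ℂ := F n.length (toPoint n)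

/-- Admissible indices: positive integers, the last of which (if any) exceeds `1`. -/
def IsAdmissible (m : List ℤ) : Prop :=
  (∀ a ∈ m, 0 < a) ∧ ∀ a ∈ m.getLast?, 1 < a

/-- The multiple zeta value of an admissible index (equal to `1` for the empty index). -/
def mzv (m : List ℤ) : ℝ :=
  ∑' x : Chain m.length, ∏ i, ((x.1 i : ℝ) ^ (m.get i))⁻¹

/-- The positive part of an index. -/
def positivePart (n : List ℤ) : List ℤ := n.filter (fun a => 0 < a)

/-- Depth of the positive part. -/
def posDepth (n : List ℤ) : ℕ := (positivePart n).length

/-- Weight of the positive part. -/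
def posWeight (n : List ℤ) : ℤ := (positivePart n).sum

/-- The rational span of the multiple zeta values of depth `≤ a` and weight `≤ b`. -/
def mzvSpan (a : ℕ) (b : ℤ) : Submodule ℚ ℝ :=
  Submodule.span ℚ {x | ∃ m : List ℤ, IsAdmissible m ∧ m.length ≤ a ∧ m.sum ≤ b ∧ x = mzv m}

/-- The rational number `ζ(-k)`. -/
def zetaNeg (k : ℕ) : ℚ := -bernoulli' (k + 1) / (k + 1)

theorem riemannZeta_neg_eq_zetaNeg (k : ℕ) : riemannZeta (-k) = (zetaNeg k : ℂ) := by
  rw [riemannZeta_neg_nat_eq_bernoulli', zetaNeg]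
  push_cast
  ring

/-- The formal combination
`-1/(m+1) · [ι(a-m-1)] + ∑_{k=0}^{m} binom(m,k) ζ(-k) · [ι(a-m+k)]`,
where `ι(x)` is the index with `x` in the place of the changed entry. -/
def absorb (ι : ℤ → List ℤ) (a : ℤ) (m : ℕ) : List ℤ →₀ ℚ :=
  Finsupp.single (ι (a - m - 1)) (-1 / ((m : ℚ) + 1)) +
    ∑ k ∈ Finset.range (m + 1),
      Finsupp.single (ι (a - m + k)) ((m.choose k : ℚ) * zetaNeg k)

/-- `RecurrenceRHS n c`: the formal rational combination `c` of indices is the right-hand side of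
the recurrence relation for `ζ_r(n)` at some entry `n_j = -m ≤ 0` of `n`. The cases are
`j = r = 1` (the value `ζ(-m)`), `j = 1 < r`, `1 < j = r`, and `1 < j < r`. -/
inductive RecurrenceRHS : List ℤ → (List ℤ →₀ ℚ) → Prop
  | single (m : ℕ) :
      RecurrenceRHS [-(m : ℤ)] (Finsupp.single [] (zetaNeg m))
  | first (m : ℕ) (b : ℤ) (B : List ℤ) :
      RecurrenceRHS (-(m : ℤ) :: b :: B)
        (-absorb (fun x => x :: B) b m
          + Finsupp.single (b :: B) (zetaNeg m)
          - Finsupp.single ((b - m) :: B) 1)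
  | last (A : List ℤ) (a : ℤ) (m : ℕ) :
      RecurrenceRHS (A ++ [a, -(m : ℤ)])
        (absorb (fun x => A ++ [x]) a m)
  | middle (A : List ℤ) (a : ℤ) (m : ℕ) (b : ℤ) (B : List ℤ) :
      RecurrenceRHS (A ++ a :: -(m : ℤ) :: b :: B)
        (absorb (fun x => A ++ x :: b :: B) a m
          - absorb (fun x => A ++ a :: x :: B) b m
          - Finsupp.single (A ++ a :: (b - m) :: B) 1)

/-- `Expands n c`: the formal rational combination `c` of indices is obtained from the index `n`
by finitely many applications of the recurrence relation. -/
inductive Expands : List ℤ → (List ℤ →₀ ℚ) → Prop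
  | refl (n : List ℤ) : Expands n (Finsupp.single n 1)
  | step (n : List ℤ) (c : List ℤ →₀ ℚ) (e : List ℤ → (List ℤ →₀ ℚ))
      (hc : RecurrenceRHS n c) (he : ∀ k ∈ c.support, Expands k (e k)) :
      Expands n (c.sum fun k q => q • e k)

end EulerZagier

end

noncomputable section

namespace EulerZagier

open Filter Topology

/-! ### Tails of `p`-series -/

/-! Continuation. For `x ≥ 1` and `Re s > 1`, Euler–Maclaurin summation gives `∑_{y > x} y ^ (-s) =
∑_{i < K+2} c_i(s) x ^ (1-s-i) + R_K(s, x)`, where `c_0 = 1/(s-1)` and, for `i ≥ 1`, `c_i` is a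
polynomial times the Bernoulli number `B_i`. The remainder is holomorphic for `s ≠ 1`, `Re s > -K`,
and has decay of order `Re s + K` in `x` (`nest_one_eq`, `tameAt_emRem`). Inserted for the last
variable of the multiple series, each power of `x` merges with the exponent `s_{r-1}`. Thus `ζ_r`
becomes `∑ c_i(s_r) ζ_{r-1}(…, s_{r-1} + s_r - 1 + i)` plus an iterated series that converges once
`K` is large. Induction on the depth continues `ζ_r` (`isMultipleZetaFunction_extend`). Since `B_i =
0` for odd `i > 1`, only the singularities in the given list arise (`IsBad.two_of_add`).

Recurrence. At `s_r = -m` the expansion terminates and the remainder vanishes, which is the relation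
at the last entry (`extend_of_last_eq_neg`). At any other entry, Abel summation against the
Faulhaber polynomial `ζ(-m) - ∑_{k ≤ x} k ^ m` proves the relation where the series converge
(`nest_neg_nest`, `nestList_append_neg_cons`). To reach a regular point, all entries except `-m` are
translated by a common `z`. The excluded `z` form a closed countable set, whose complement in the
plane is connected, so the identity theorem applies (`eqOn_of_eventually_re`). The same argument
gives uniqueness of the continuation (`IsMultipleZetaFunction.eq_of_regular`).

Reduction. Every use of the recurrence shortens the index and never raises an entry, so the depth
and weight of the positive part do not grow. It also preserves regularity. The process ends at
regular indices with positive entries only, and these are admissible (`exists_expands`). -/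

theorem rpow_neg_le_sub_rpow {τ x : ℝ} (hτ : 1 < τ) (hx : 0 < x) :
    (x + 1) ^ (-τ) ≤ (x ^ (1 - τ) - (x + 1) ^ (1 - τ)) / (τ - 1) := by
  have hx1 : 0 < x + 1 := by linarith
  have hp : 0 < τ - 1 := by linarith
  have hA : 0 < x / (x + 1) := by positivity
  -- Bernoulli's inequality with a negative exponent, from `log y ≤ y - 1` at `y = x / (x + 1)` and
  -- `1 + t ≤ exp t`.
  have h1 : 1 + (τ - 1) * (1 / (x + 1)) ≤ (x / (x + 1)) ^ (1 - τ) := by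
    rw [Real.rpow_def_of_pos hA]
    have h2 := Real.log_le_sub_one_of_pos hA
    have h3 := Real.add_one_le_exp (Real.log (x / (x + 1)) * (1 - τ))
    have h4 : x / (x + 1) - 1 = -(1 / (x + 1)) := by field_simp; ring
    rw [h4] at h2
    nlinarith
  rw [Real.div_rpow hx.le hx1.le, le_div_iff₀ (by positivity)] at h1
  rw [le_div_iff₀ hp]
  have h5 : (x + 1) ^ (1 - τ) = (x + 1) ^ (-τ) * (x + 1) := by
    rw [← Real.rpow_add_one hx1.ne']; ring_nf
  rw [h5] at h1 ⊢
  have h6 : (1 + (τ - 1) * (1 / (x + 1))) * ((x + 1) ^ (-τ) * (x + 1))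
      = (x + 1) ^ (-τ) * (x + 1) + (x + 1) ^ (-τ) * (τ - 1) := by
    field_simp
  linarith

theorem summable_add_rpow_neg {τ : ℝ} (hτ : 1 < τ) (u : ℕ) :
    Summable fun n : ℕ => ((u + n : ℕ) : ℝ) ^ (-τ) := by
  have h := (summable_nat_add_iff (f := fun n : ℕ => (n : ℝ) ^ (-τ)) u).2
    (Real.summable_nat_rpow.2 (by linarith))
  simpa only [add_comm] using h

/-- The integral comparison telescopes for all terms after the first. The first term `u ^ (-τ)` is
absorbed by `u ^ (1 - τ)`, which accounts for the `1` in the constant. -/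
theorem tsum_add_rpow_neg_le {τ : ℝ} (hτ : 1 < τ) {u : ℕ} (hu : 1 ≤ u) :
    ∑' n : ℕ, ((u + n : ℕ) : ℝ) ^ (-τ) ≤ (1 + 1 / (τ - 1)) * (u : ℝ) ^ (1 - τ) := by
  have hp : 0 < τ - 1 := by linarith
  have hu0 : (0 : ℝ) < u := by exact_mod_cast hu
  have hu1 : (1 : ℝ) ≤ u := by exact_mod_cast hu
  have key : ∀ N : ℕ, ∑ n ∈ Finset.range (N + 1), ((u + n : ℕ) : ℝ) ^ (-τ) ≤
      (u : ℝ) ^ (-τ) + ((u : ℝ) ^ (1 - τ) - ((u + N : ℕ) : ℝ) ^ (1 - τ)) / (τ - 1) := by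
    intro N
    induction N with
    | zero => simp
    | succ N ih =>
      rw [Finset.sum_range_succ]
      have h := rpow_neg_le_sub_rpow hτ (x := ((u + N : ℕ) : ℝ)) (by push_cast; positivity)
      have e : ((u + (N + 1) : ℕ) : ℝ) = ((u + N : ℕ) : ℝ) + 1 := by push_cast; ring
      rw [e]
      have := add_le_add ih h
      refine this.trans (le_of_eq ?_)
      ring
  refine Real.tsum_le_of_sum_range_le (fun n => by positivity) fun N => ?_
  have h1 : ∑ n ∈ Finset.range N, ((u + n : ℕ) : ℝ) ^ (-τ) ≤
      ∑ n ∈ Finset.range (N + 1), ((u + n : ℕ) : ℝ) ^ (-τ) := by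
    rw [Finset.sum_range_succ]
    have : (0 : ℝ) ≤ ((u + N : ℕ) : ℝ) ^ (-τ) := by positivity
    linarith
  refine (h1.trans (key N)).trans ?_
  have h2 : (u : ℝ) ^ (-τ) ≤ (u : ℝ) ^ (1 - τ) :=
    Real.rpow_le_rpow_of_exponent_le hu1 (by linarith)
  have h3 : (0 : ℝ) ≤ ((u + N : ℕ) : ℝ) ^ (1 - τ) / (τ - 1) := by positivity
  have h4 : (u : ℝ) ^ (-τ) + ((u : ℝ) ^ (1 - τ) - ((u + N : ℕ) : ℝ) ^ (1 - τ)) / (τ - 1)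
      = (u : ℝ) ^ (-τ) + (u : ℝ) ^ (1 - τ) / (τ - 1) - ((u + N : ℕ) : ℝ) ^ (1 - τ) / (τ - 1) := by
    ring
  have h5 : (1 + 1 / (τ - 1)) * (u : ℝ) ^ (1 - τ)
      = (u : ℝ) ^ (1 - τ) + (u : ℝ) ^ (1 - τ) / (τ - 1) := by ring
  linarith

/-! ### Series of holomorphic functions on normed spaces -/

section Series

variable {E : Type*} [NormedAddCommGroup E] [NormedSpace ℂ E]

/-- Cauchy's estimate on the complex line `z ↦ e + z v`. The radius is halved so that the closed
disc stays inside the open ball. -/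
theorem norm_fderiv_le_of_forall_ball {f : E → ℂ} {e : E} {r b : ℝ} (hr : 0 < r)
    (hd : ∀ x ∈ Metric.ball e r, DifferentiableAt ℂ f x)
    (hb : ∀ x ∈ Metric.ball e r, ‖f x‖ ≤ b) : ‖fderiv ℂ f e‖ ≤ b / (r / 2) := by
  have hb0 : 0 ≤ b := (norm_nonneg _).trans (hb e (Metric.mem_ball_self hr))
  refine ContinuousLinearMap.opNorm_le_bound _ (by positivity) fun v => ?_
  by_cases hv : v = 0
  · simp [hv]
  have hv0 : 0 < ‖v‖ := norm_pos_iff.2 hv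
  have hmem : ∀ z ∈ Metric.closedBall (0 : ℂ) (r / 2 / ‖v‖), e + z • v ∈ Metric.ball e r := by
    intro z hz
    rw [mem_closedBall_zero_iff, le_div_iff₀ hv0] at hz
    rw [Metric.mem_ball, dist_self_add_left, norm_smul]
    linarith
  have hline : ∀ z : ℂ, HasDerivAt (fun z : ℂ => e + z • v) v z := fun z => by
    simpa using ((hasDerivAt_id z).smul_const v).const_add e
  have hdiff : ∀ z ∈ Metric.closedBall (0 : ℂ) (r / 2 / ‖v‖),
      DifferentiableAt ℂ (fun z : ℂ => f (e + z • v)) z := fun z hz =>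
    (hd _ (hmem z hz)).comp z (hline z).differentiableAt
  have hR : 0 < r / 2 / ‖v‖ := by positivity
  have h1 : deriv (fun z : ℂ => f (e + z • v)) 0 = fderiv ℂ f e v := by
    have h0 : HasFDerivAt f (fderiv ℂ f e) (e + (0 : ℂ) • v) := by
      simpa using (hd e (Metric.mem_ball_self hr)).hasFDerivAt
    exact (h0.comp_hasDerivAt (0 : ℂ) (hline 0)).deriv
  have h2 : ‖deriv (fun z : ℂ => f (e + z • v)) 0‖ ≤ b / (r / 2 / ‖v‖) := by
    refine Complex.norm_deriv_le_of_forall_mem_sphere_norm_le hR ?_ fun z hz =>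
      hb _ (hmem z (Metric.sphere_subset_closedBall hz))
    refine DifferentiableOn.diffContOnCl fun z hz => ?_
    rw [closure_ball _ hR.ne'] at hz
    exact (hdiff z hz).differentiableWithinAt
  rw [h1] at h2
  refine h2.trans (le_of_eq ?_)
  field_simp

/-- Weierstrass's theorem: Cauchy's estimate turns a summable bound for the functions into one for
their derivatives. Around each point of the smaller ball, a ball of radius `r` still lies in the
larger one. -/
theorem differentiableAt_tsum_of_forall_ball {ι : Type*} {ψ : ι → E → ℂ} {e₀ e : E} {r : ℝ}
    {b : ι → ℝ} (hd : ∀ x ∈ Metric.ball e₀ (2 * r), ∀ n, DifferentiableAt ℂ (ψ n) x)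
    (hs : Summable b) (hb : ∀ x ∈ Metric.ball e₀ (2 * r), ∀ n, ‖ψ n x‖ ≤ b n)
    (he : e ∈ Metric.ball e₀ r) : DifferentiableAt ℂ (fun x => ∑' n, ψ n x) e := by
  have hr : 0 < r := Metric.pos_of_mem_ball he
  have hsub : ∀ x ∈ Metric.ball e₀ r, Metric.ball x r ⊆ Metric.ball e₀ (2 * r) := by
    intro x hx
    refine Metric.ball_subset_ball' ?_
    rw [Metric.mem_ball] at hx
    linarith
  have hsub' : Metric.ball e₀ r ⊆ Metric.ball e₀ (2 * r) :=
    Metric.ball_subset_ball (by linarith)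
  -- The real structure serves only to express that the ball is convex, hence preconnected.
  let _ : NormedSpace ℝ E := NormedSpace.restrictScalars ℝ ℂ E
  refine (hasFDerivAt_tsum_of_isPreconnected (hs.div_const (r / 2)) Metric.isOpen_ball
    (convex_ball e₀ r).isPreconnected
    (fun n x hx => (hd x (hsub' hx) n).hasFDerivAt)
    (fun n x hx => norm_fderiv_le_of_forall_ball hr (fun y hy => hd y (hsub x hx hy) n)
      (fun y hy => hb y (hsub x hx hy) n))
    he (.of_norm_bounded hs fun n => hb e (hsub' he) n) he).differentiableAt

end Series

/-! ### Sequences of holomorphic functions of power decay -/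

/-- The sequence `φ` is `O(u ^ (-ρ'))` for all `ρ' < ρ`. -/
def Decay (φ : ℕ → ℂ) (ρ : ℝ) : Prop :=
  ∀ ρ' < ρ, ∃ C : ℝ, ∀ u ≥ 1, ‖φ u‖ ≤ C * (u : ℝ) ^ (-ρ')

/-- Near `e₀`, the functions `Φ u` with `u ≥ 1` are holomorphic and `O(u ^ (-ρ'))` for all
`ρ' < ρ`, uniformly in the parameter. -/
structure TameAt {E : Type*} [NormedAddCommGroup E] [NormedSpace ℂ E] (e₀ : E)
    (Φ : ℕ → E → ℂ) (ρ : ℝ) : Prop where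
  diff : ∀ᶠ e in 𝓝 e₀, ∀ u ≥ 1, DifferentiableAt ℂ (Φ u) e
  bound : ∀ ρ' < ρ, ∃ C : ℝ, ∀ᶠ e in 𝓝 e₀, ∀ u ≥ 1, ‖Φ u e‖ ≤ C * (u : ℝ) ^ (-ρ')

/-- `∑_{x ≥ u} ψ(x)`. -/
def tailSeries (ψ : ℕ → ℂ) (u : ℕ) : ℂ := ∑' n : ℕ, ψ (u + n)

/-- `∑_{x > u} x ^ (-a) φ(x)`. -/
def nest (a : ℂ) (φ : ℕ → ℂ) (u : ℕ) : ℂ := tailSeries (fun x => (x : ℂ) ^ (-a) * φ x) (u + 1)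

theorem rpow_neg_le_rpow_neg {u : ℕ} (hu : 1 ≤ u) {a b : ℝ} (h : a ≤ b) :
    (u : ℝ) ^ (-b) ≤ (u : ℝ) ^ (-a) :=
  Real.rpow_le_rpow_of_exponent_le (by exact_mod_cast hu) (by linarith)

theorem Decay.mono {φ : ℕ → ℂ} {ρ σ : ℝ} (h : Decay φ ρ) (hσ : σ ≤ ρ) : Decay φ σ :=
  fun ρ' hρ' => h ρ' (hρ'.trans_le hσ)

theorem Decay.congr {φ ψ : ℕ → ℂ} {ρ : ℝ} (h : Decay φ ρ) (he : ∀ u ≥ 1, φ u = ψ u) :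
    Decay ψ ρ := fun ρ' hρ' => by
  obtain ⟨C, hC⟩ := h ρ' hρ'
  exact ⟨C, fun u hu => by rw [← he u hu]; exact hC u hu⟩

theorem Decay.add {φ ψ : ℕ → ℂ} {ρ : ℝ} (h : Decay φ ρ) (h' : Decay ψ ρ) :
    Decay (fun x => φ x + ψ x) ρ := fun ρ' hρ' => by
  obtain ⟨C, hC⟩ := h ρ' hρ'
  obtain ⟨D, hD⟩ := h' ρ' hρ'
  refine ⟨C + D, fun u hu => (norm_add_le _ _).trans ?_⟩
  rw [add_mul]
  exact add_le_add (hC u hu) (hD u hu)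

theorem Decay.const_mul {φ : ℕ → ℂ} {ρ : ℝ} (c : ℂ) (h : Decay φ ρ) :
    Decay (fun x => c * φ x) ρ := fun ρ' hρ' => by
  obtain ⟨C, hC⟩ := h ρ' hρ'
  refine ⟨‖c‖ * C, fun u hu => ?_⟩
  rw [norm_mul, mul_assoc]
  exact mul_le_mul_of_nonneg_left (hC u hu) (norm_nonneg _)

theorem Decay.sum {ι : Type*} (s : Finset ι) {φ : ι → ℕ → ℂ} {ρ : ℝ}
    (h : ∀ i ∈ s, Decay (φ i) ρ) : Decay (fun x => ∑ i ∈ s, φ i x) ρ := by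
  classical
  induction s using Finset.induction_on with
  | empty =>
    intro ρ' _
    exact ⟨0, fun u _ => by simp⟩
  | insert i s hi ih =>
    simp only [Finset.sum_insert hi]
    exact (h i (by simp)).add (ih fun j hj => h j (by simp [hj]))

theorem Decay.cpow_mul {φ : ℕ → ℂ} {ρ : ℝ} (h : Decay φ ρ) (a : ℂ) :
    Decay (fun x => (x : ℂ) ^ (-a) * φ x) (a.re + ρ) := fun ρ' hρ' => by
  obtain ⟨C, hC⟩ := h (ρ' - a.re) (by linarith)
  refine ⟨C, fun u hu => ?_⟩
  have hu0 : (0 : ℝ) < u := by exact_mod_cast hu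
  rw [norm_mul, Complex.norm_natCast_cpow_of_pos (by omega), Complex.neg_re]
  refine (mul_le_mul_of_nonneg_left (hC u hu) (by positivity)).trans (le_of_eq ?_)
  rw [mul_left_comm, ← Real.rpow_add hu0]
  ring_nf

theorem decay_one : Decay (fun _ => 1) 0 := fun ρ' hρ' => by
  refine ⟨1, fun u hu => ?_⟩
  have := rpow_neg_le_rpow_neg hu hρ'.le
  simpa using this

theorem Decay.summable_tail {ψ : ℕ → ℂ} {ρ : ℝ} (h : Decay ψ ρ) (hρ : 1 < ρ) {u : ℕ}
    (hu : 1 ≤ u) : Summable fun n => ‖ψ (u + n)‖ := by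
  obtain ⟨τ, h1, h2⟩ := exists_between hρ
  obtain ⟨C, hC⟩ := h τ h2
  exact Summable.of_norm_bounded ((summable_add_rpow_neg h1 u).mul_left C) fun n => by
    simpa using hC (u + n) (by omega)

theorem Decay.summable_nest {φ : ℕ → ℂ} {ρ : ℝ} (h : Decay φ ρ) {a : ℂ} (ha : 1 < a.re + ρ)
    (u : ℕ) : Summable fun n => ‖((u + 1 + n : ℕ) : ℂ) ^ (-a) * φ (u + 1 + n)‖ :=
  (h.cpow_mul a).summable_tail ha (by omega)

theorem Decay.tendsto_zero {φ : ℕ → ℂ} {ρ : ℝ} (h : Decay φ ρ) (hρ : 0 < ρ) :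
    Tendsto φ atTop (𝓝 0) := by
  obtain ⟨τ, h1, h2⟩ := exists_between hρ
  obtain ⟨C, hC⟩ := h τ h2
  refine squeeze_zero_norm' ((eventually_ge_atTop 1).mono hC) ?_
  simpa using ((tendsto_rpow_neg_atTop h1).comp tendsto_natCast_atTop_atTop).const_mul C

/-- Telescoping. -/
theorem tailSeries_sub_succ {D : ℕ → ℂ} {u : ℕ} (hs : Summable fun n => D (u + n) - D (u + n + 1))
    (hD : Tendsto D atTop (𝓝 0)) : tailSeries (fun x => D x - D (x + 1)) u = D u := by
  have h1 := hs.hasSum.tendsto_sum_nat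
  have h2 : ∀ N, ∑ n ∈ Finset.range N, (D (u + n) - D (u + n + 1)) = D u - D (u + N) := fun N => by
    have := Finset.sum_range_sub' (fun n => D (u + n)) N
    simpa [add_assoc] using this
  simp only [h2] at h1
  have h3 : Tendsto (fun N => D u - D (u + N)) atTop (𝓝 (D u - 0)) := by
    refine tendsto_const_nhds.sub (hD.comp ?_)
    exact tendsto_atTop_mono (fun N => Nat.le_add_left N u) tendsto_id
  simpa [tailSeries] using tendsto_nhds_unique h1 h3

/-! ### Holomorphic families of sequences and their tail sums -/

section Tame

variable {E : Type*} [NormedAddCommGroup E] [NormedSpace ℂ E] {e₀ : E}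

theorem TameAt.decay {Φ : ℕ → E → ℂ} {ρ : ℝ} (h : TameAt e₀ Φ ρ) :
    Decay (fun u => Φ u e₀) ρ := fun ρ' hρ' => by
  obtain ⟨C, hC⟩ := h.bound ρ' hρ'
  exact ⟨C, hC.self_of_nhds⟩

theorem Decay.tameAt {φ : ℕ → ℂ} {ρ : ℝ} (h : Decay φ ρ) : TameAt e₀ (fun u _ => φ u) ρ where
  diff := Eventually.of_forall fun _ _ _ => differentiableAt_const _
  bound ρ' hρ' := by
    obtain ⟨C, hC⟩ := h ρ' hρ'
    exact ⟨C, Eventually.of_forall fun _ => hC⟩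

theorem differentiableAt_natCast_cpow_neg {u : ℕ} (hu : 1 ≤ u) {a : E → ℂ} {e : E}
    (ha : DifferentiableAt ℂ a e) : DifferentiableAt ℂ (fun x => (u : ℂ) ^ (-a x)) e :=
  ha.neg.const_cpow (Or.inl (by exact_mod_cast (by omega : u ≠ 0)))

theorem TameAt.cpow_mul {Φ : ℕ → E → ℂ} {ρ : ℝ} (h : TameAt e₀ Φ ρ) {a : E → ℂ}
    (ha : ∀ᶠ e in 𝓝 e₀, DifferentiableAt ℂ a e) :
    TameAt e₀ (fun u e => (u : ℂ) ^ (-a e) * Φ u e) ((a e₀).re + ρ) where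
  diff := by
    filter_upwards [ha, h.diff] with e h1 h2 u hu
    exact (differentiableAt_natCast_cpow_neg hu h1).mul (h2 u hu)
  bound ρ' hρ' := by
    -- Half of the gap between `ρ'` and the claimed order absorbs the variation of `Re a` near `e₀`.
    obtain ⟨δ, hδ, hδ'⟩ : ∃ δ, 0 < δ ∧ ρ' + δ < (a e₀).re + ρ :=
      ⟨((a e₀).re + ρ - ρ') / 2, by linarith, by linarith⟩
    obtain ⟨C, hC⟩ := h.bound (ρ' + δ - (a e₀).re) (by linarith)
    have hcont : ContinuousAt (fun e => (a e).re) e₀ :=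
      Complex.continuous_re.continuousAt.comp ha.self_of_nhds.continuousAt
    refine ⟨C, ?_⟩
    filter_upwards [hC, hcont.eventually_const_lt (show (a e₀).re - δ < (a e₀).re by linarith)]
      with e h1 h2 u hu
    have hu0 : (0 : ℝ) < u := by exact_mod_cast hu
    rw [norm_mul, Complex.norm_natCast_cpow_of_pos (by omega), Complex.neg_re]
    have h3 := (norm_nonneg _).trans (h1 u hu)
    refine (mul_le_mul (rpow_neg_le_rpow_neg hu h2.le) (h1 u hu) (norm_nonneg _)
      (by positivity)).trans (le_of_eq ?_)
    rw [mul_left_comm, ← Real.rpow_add hu0]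
    ring_nf

/-- Summation costs one order of decay. An exponent strictly between the required one and `ρ`
provides both the summable majorant and the bound of the tail. -/
theorem TameAt.tailSeries {Ψ : ℕ → E → ℂ} {ρ : ℝ} (h : TameAt e₀ Ψ ρ) (hρ : 1 < ρ) :
    TameAt e₀ (fun u e => tailSeries (fun x => Ψ x e) u) (ρ - 1) where
  diff := by
    obtain ⟨τ, h1, h2⟩ := exists_between hρ
    obtain ⟨C, hC⟩ := h.bound τ h2
    obtain ⟨r, hr, hball⟩ := Metric.eventually_nhds_iff_ball.1 (hC.and h.diff)
    have hr2 : 2 * (r / 2) = r := by ring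
    filter_upwards [Metric.ball_mem_nhds e₀ (half_pos hr)] with e he u hu
    refine differentiableAt_tsum_of_forall_ball (r := r / 2)
      (fun x hx n => (hball x (hr2 ▸ hx)).2 (u + n) (by omega))
      ((summable_add_rpow_neg h1 u).mul_left C)
      (fun x hx n => (hball x (hr2 ▸ hx)).1 (u + n) (by omega)) he
  bound ρ' hρ' := by
    obtain ⟨τ, h1, h2⟩ : ∃ τ, max 1 (ρ' + 1) < τ ∧ τ < ρ :=
      exists_between (max_lt hρ (by linarith))
    have h1' : 1 < τ := (le_max_left _ _).trans_lt h1
    have h1'' : ρ' + 1 < τ := (le_max_right _ _).trans_lt h1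
    obtain ⟨C, hC⟩ := h.bound τ h2
    refine ⟨C * (1 + 1 / (τ - 1)), ?_⟩
    filter_upwards [hC] with e he u hu
    have hC0 : 0 ≤ C := by simpa using (norm_nonneg _).trans (he 1 le_rfl)
    have hs := summable_add_rpow_neg h1' u
    refine (tsum_of_norm_bounded (hs.mul_left C).hasSum
      fun n => he (u + n) (by omega)).trans ?_
    rw [tsum_mul_left, mul_assoc]
    refine mul_le_mul_of_nonneg_left ((tsum_add_rpow_neg_le h1' hu).trans ?_) hC0
    have : 0 < τ - 1 := by linarith
    refine mul_le_mul_of_nonneg_left ?_ (by positivity)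
    have := rpow_neg_le_rpow_neg hu (show ρ' ≤ τ - 1 by linarith)
    rwa [neg_sub] at this

/-- The order survives since `(1 + 1/u) ^ (-ρ')` is at most `2 ^ |ρ'|` for `u ≥ 1`. It is needed
because `nest` sums over `x > u` rather than `x ≥ u`. -/
theorem TameAt.shift {Φ : ℕ → E → ℂ} {ρ : ℝ} (h : TameAt e₀ Φ ρ) :
    TameAt e₀ (fun u e => Φ (u + 1) e) ρ where
  diff := by
    filter_upwards [h.diff] with e he u _
    exact he (u + 1) (by omega)
  bound ρ' hρ' := by
    obtain ⟨C, hC⟩ := h.bound ρ' hρ'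
    refine ⟨C * 2 ^ |ρ'|, ?_⟩
    filter_upwards [hC] with e he u hu
    have hC0 : 0 ≤ C := by simpa using (norm_nonneg _).trans (he 1 le_rfl)
    refine (he (u + 1) (by omega)).trans ?_
    rw [mul_assoc]
    refine mul_le_mul_of_nonneg_left ?_ hC0
    have hu1 : (1 : ℝ) ≤ u := by exact_mod_cast hu
    have hu0 : (0 : ℝ) < u := by linarith
    have hq : ((u + 1 : ℕ) : ℝ) = (1 + 1 / u) * u := by push_cast; field_simp
    have hq1 : 1 ≤ 1 + 1 / (u : ℝ) := by
      have : 0 ≤ 1 / (u : ℝ) := by positivity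
      linarith
    have hq2 : 1 + 1 / (u : ℝ) ≤ 2 := by
      have : 1 / (u : ℝ) ≤ 1 := by rw [div_le_one hu0]; exact hu1
      linarith
    rw [hq, Real.mul_rpow (by positivity) hu0.le]
    refine mul_le_mul_of_nonneg_right ?_ (by positivity)
    calc (1 + 1 / (u : ℝ)) ^ (-ρ') ≤ (1 + 1 / (u : ℝ)) ^ |ρ'| :=
          Real.rpow_le_rpow_of_exponent_le hq1 (neg_le_abs ρ')
      _ ≤ 2 ^ |ρ'| := Real.rpow_le_rpow (by positivity) hq2 (abs_nonneg _)

theorem TameAt.nest {Φ : ℕ → E → ℂ} {ρ : ℝ} (h : TameAt e₀ Φ ρ) {a : E → ℂ}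
    (ha : ∀ᶠ e in 𝓝 e₀, DifferentiableAt ℂ a e) (hρ : 1 < (a e₀).re + ρ) :
    TameAt e₀ (fun u e => nest (a e) (fun x => Φ x e) u) ((a e₀).re + ρ - 1) :=
  ((h.cpow_mul ha).tailSeries hρ).shift

/-- Here `u = 0` is allowed, as the sum starts at `u + 1 ≥ 1`. The zeta function itself is the value
at `u = 0`. -/
theorem TameAt.differentiableAt_nest {Φ : ℕ → E → ℂ} {ρ : ℝ} (h : TameAt e₀ Φ ρ) {a : E → ℂ}
    (ha : ∀ᶠ e in 𝓝 e₀, DifferentiableAt ℂ a e) (hρ : 1 < (a e₀).re + ρ) (u : ℕ) :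
    DifferentiableAt ℂ (fun e => EulerZagier.nest (a e) (fun x => Φ x e) u) e₀ :=
  ((h.cpow_mul ha).tailSeries hρ).diff.self_of_nhds (u + 1) (by omega)

theorem TameAt.mono {Φ : ℕ → E → ℂ} {ρ σ : ℝ} (h : TameAt e₀ Φ ρ) (hσ : σ ≤ ρ) :
    TameAt e₀ Φ σ :=
  ⟨h.diff, fun ρ' hρ' => h.bound ρ' (hρ'.trans_le hσ)⟩

end Tame

theorem Decay.nest {φ : ℕ → ℂ} {ρ : ℝ} (h : Decay φ ρ) {a : ℂ} (ha : 1 < a.re + ρ) :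
    Decay (nest a φ) (a.re + ρ - 1) :=
  (TameAt.nest (e₀ := (0 : ℂ)) h.tameAt (a := fun _ => a)
    (Eventually.of_forall fun _ => differentiableAt_const _) ha).decay

/-! ### Euler–Maclaurin summation of `∑ y ^ (-s)` -/

/-- `s (s + 1) ⋯ (s + k - 1)`. -/
def rising (k : ℕ) (s : ℂ) : ℂ := ∏ i ∈ Finset.range k, (s + i)

/-- The coefficients of the asymptotic expansion
`∑_{y > x} y ^ (-s) ∼ ∑_i emCoeff i s · x ^ (1 - s - i)`. -/
def emCoeff : ℕ → ℂ → ℂ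
  | 0, s => (s - 1)⁻¹
  | k + 1, s => rising k s * ((bernoulli (k + 1) : ℚ) : ℂ) / ((k + 1).factorial : ℂ)

/-- The first `K + 2` terms of the asymptotic expansion. -/
def emMain (K : ℕ) (s : ℂ) (x : ℕ) : ℂ :=
  ∑ i ∈ Finset.range (K + 2), emCoeff i s * (x : ℂ) ^ (-(s - 1 + i))

/-- The defect of `emMain` as a solution of `f x - f (x + 1) = (x + 1) ^ (-s)`. -/
def emStep (K : ℕ) (s : ℂ) (x : ℕ) : ℂ :=
  ((x + 1 : ℕ) : ℂ) ^ (-s) - (emMain K s x - emMain K s (x + 1))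

/-- The remainder term. -/
def emRem (K : ℕ) (s : ℂ) (x : ℕ) : ℂ := tailSeries (emStep K s) x

/-- `∫₀¹ B_k(t) (x + t) ^ (-s-k) dt`. -/
def emInt (k : ℕ) (s : ℂ) (x : ℕ) : ℂ :=
  ∫ t in (0 : ℝ)..1, (((x : ℝ) + t : ℝ) : ℂ) ^ (-(s + k)) * (bernoulliFun k t : ℂ)

theorem rising_succ (k : ℕ) (s : ℂ) : rising (k + 1) s = rising k s * (s + k) :=
  Finset.prod_range_succ _ _

theorem emMain_succ (K : ℕ) (s : ℂ) (x : ℕ) :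
    emMain (K + 1) s x = emMain K s x + emCoeff (K + 2) s * (x : ℂ) ^ (-(s + (K + 1))) := by
  rw [emMain, Finset.sum_range_succ]
  have : s - 1 + ((K + 2 : ℕ) : ℂ) = s + (K + 1) := by push_cast; ring
  rw [this]
  rfl

theorem hasDerivAt_add_ofReal_cpow {x t : ℝ} (h : 0 < x + t) (w : ℂ) :
    HasDerivAt (fun t : ℝ => ((x + t : ℝ) : ℂ) ^ (-w))
      (-w * ((x + t : ℝ) : ℂ) ^ (-(w + 1))) t := by
  have h1 : HasDerivAt (fun t : ℝ => ((x + t : ℝ) : ℂ)) 1 t := by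
    simpa using ((hasDerivAt_id t).const_add x).ofReal_comp
  have hm : ((x + t : ℝ) : ℂ) ∈ Complex.slitPlane := Or.inl (by simpa using h)
  have h2 := ((hasDerivAt_id ((x + t : ℝ) : ℂ)).cpow_const (c := -w) hm).comp t h1
  refine h2.congr_deriv ?_
  simp only [id, mul_one]
  ring_nf

/-- Integration by parts, with `B_{k+1} / (k+1)` as a primitive of `B_k`. -/
theorem emInt_eq {x : ℕ} (hx : 1 ≤ x) (k : ℕ) (s : ℂ) :
    emInt k s x = ((x + 1 : ℕ) : ℂ) ^ (-(s + k)) * ((bernoulliFun (k + 1) 1 : ℂ) / (k + 1))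
      - (x : ℂ) ^ (-(s + k)) * ((bernoulliFun (k + 1) 0 : ℂ) / (k + 1))
      + (s + k) / (k + 1) * emInt (k + 1) s x := by
  have hx0 : (0 : ℝ) < x := by exact_mod_cast hx
  have hk : ((k : ℂ) + 1) ≠ 0 := by exact_mod_cast k.succ_ne_zero
  have hpos : ∀ t ∈ Set.uIcc (0 : ℝ) 1, (0 : ℝ) < x + t := by
    intro t ht
    rw [Set.uIcc_of_le zero_le_one] at ht
    linarith [ht.1]
  have hv : ∀ t : ℝ, HasDerivAt (fun t : ℝ => (bernoulliFun (k + 1) t : ℂ) / (k + 1))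
      (bernoulliFun k t : ℂ) t := by
    intro t
    have h := ((hasDerivAt_bernoulliFun (k + 1) t).ofReal_comp).div_const ((k : ℂ) + 1)
    refine h.congr_deriv ?_
    push_cast
    field_simp
  have hcont : ∀ w : ℂ, ContinuousOn (fun t : ℝ => (((x : ℝ) + t : ℝ) : ℂ) ^ (-w))
      (Set.uIcc (0 : ℝ) 1) := fun w t ht =>
    (hasDerivAt_add_ofReal_cpow (hpos t ht) w).continuousAt.continuousWithinAt
  have key := intervalIntegral.integral_mul_deriv_eq_deriv_mul
    (u := fun t : ℝ => (((x : ℝ) + t : ℝ) : ℂ) ^ (-(s + k)))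
    (v := fun t : ℝ => (bernoulliFun (k + 1) t : ℂ) / (k + 1))
    (fun t ht => hasDerivAt_add_ofReal_cpow (hpos t ht) (s + k)) (fun t _ => hv t)
    ((continuousOn_const.mul (hcont _)).intervalIntegrable)
    (Complex.continuous_ofReal.comp (continuous_bernoulliFun k)).continuousOn.intervalIntegrable
  rw [emInt, key]
  have h2 : ∀ t : ℝ, -(s + k) * (((x : ℝ) + t : ℝ) : ℂ) ^ (-(s + k + 1)) *
      ((bernoulliFun (k + 1) t : ℂ) / (k + 1)) = (-((s + k) / (k + 1))) *
      ((((x : ℝ) + t : ℝ) : ℂ) ^ (-(s + (k + 1 : ℕ))) * (bernoulliFun (k + 1) t : ℂ)) := by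
    intro t
    have : s + ((k + 1 : ℕ) : ℂ) = s + k + 1 := by push_cast; ring
    rw [this]
    field_simp
  simp only [h2, intervalIntegral.integral_const_mul]
  rw [emInt]
  push_cast
  simp only [add_zero]
  ring

theorem emInt_zero {x : ℕ} (hx : 1 ≤ x) {s : ℂ} (hs : s ≠ 1) :
    emInt 0 s x = (s - 1)⁻¹ * (x : ℂ) ^ (-(s - 1)) -
      (s - 1)⁻¹ * ((x + 1 : ℕ) : ℂ) ^ (-(s - 1)) := by
  have hx0 : (0 : ℝ) < x := by exact_mod_cast hx
  have hs' : s - 1 ≠ 0 := sub_ne_zero.2 hs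
  have hpos : ∀ t ∈ Set.uIcc (0 : ℝ) 1, (0 : ℝ) < x + t := by
    intro t ht
    rw [Set.uIcc_of_le zero_le_one] at ht
    linarith [ht.1]
  have hd : ∀ t ∈ Set.uIcc (0 : ℝ) 1, HasDerivAt
      (fun t : ℝ => -(s - 1)⁻¹ * (((x : ℝ) + t : ℝ) : ℂ) ^ (-(s - 1)))
      ((((x : ℝ) + t : ℝ) : ℂ) ^ (-s)) t := by
    intro t ht
    refine ((hasDerivAt_add_ofReal_cpow (hpos t ht) (s - 1)).const_mul
      (-(s - 1)⁻¹)).congr_deriv ?_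
    rw [sub_add_cancel]
    field_simp
  have hi : IntervalIntegrable (fun t : ℝ => (((x : ℝ) + t : ℝ) : ℂ) ^ (-s))
      MeasureTheory.volume 0 1 := ContinuousOn.intervalIntegrable fun t ht =>
    (hasDerivAt_add_ofReal_cpow (hpos t ht) s).continuousAt.continuousWithinAt
  have := intervalIntegral.integral_eq_sub_of_hasDerivAt hd hi
  rw [emInt]
  simp only [Nat.cast_zero, add_zero, bernoulliFun_zero, Complex.ofReal_one, mul_one]
  rw [this]
  push_cast
  simp only [add_zero]
  ring

/-- Each integration by parts produces, as its boundary term, the next term of `emMain`. The start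
is the exact integral of `t ^ (-s)` over `[x, x+1]`. -/
theorem emStep_eq {x : ℕ} (hx : 1 ≤ x) {s : ℂ} (hs : s ≠ 1) (K : ℕ) :
    emStep K s x =
      -(rising (K + 1) s / ((K + 1).factorial : ℂ) * emInt (K + 1) s x) := by
  induction K with
  | zero =>
    have h1 := emInt_eq hx 0 s
    rw [emInt_zero hx hs] at h1
    have h2 : emMain 0 s = fun x : ℕ => (s - 1)⁻¹ * (x : ℂ) ^ (-(s - 1)) +
        (-1 / 2 : ℂ) * (x : ℂ) ^ (-s) := by
      funext x
      simp [emMain, Finset.sum_range_succ, emCoeff, rising]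
      ring_nf
    rw [emStep, h2]
    simp only [Nat.cast_zero, add_zero, zero_add, bernoulliFun_one] at h1
    simp only [zero_add, Nat.factorial_one, Nat.cast_one, div_one, rising,
      Finset.prod_range_one, Nat.cast_zero, add_zero]
    push_cast at h1 ⊢
    linear_combination -h1
  | succ K ih =>
    have h1 := emInt_eq hx (K + 1) s
    -- From degree two on, the Bernoulli polynomials agree at `0` and `1`, so the boundary terms
    -- combine into a single difference.
    have hB : bernoulliFun (K + 1 + 1) 1 = bernoulliFun (K + 1 + 1) 0 :=
      bernoulliFun_endpoints_eq_of_ne_one (by omega)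
    rw [hB, bernoulliFun_eval_zero] at h1
    have h2 : emStep (K + 1) s x = emStep K s x - emCoeff (K + 2) s *
        ((x : ℂ) ^ (-(s + (K + 1))) - ((x + 1 : ℕ) : ℂ) ^ (-(s + (K + 1)))) := by
      rw [emStep, emStep, emMain_succ, emMain_succ]
      ring
    rw [h2, ih, h1, emCoeff, rising_succ (K + 1)]
    have hf : ((K + 1 + 1).factorial : ℂ) = (K + 1 + 1) * ((K + 1).factorial : ℂ) := by
      rw [Nat.factorial_succ (K + 1)]; push_cast; ring
    have h3 : ((K : ℂ) + 1 + 1) ≠ 0 := by exact_mod_cast (K + 1).succ_ne_zero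
    have h4 : ((K + 1).factorial : ℂ) ≠ 0 := by exact_mod_cast (K + 1).factorial_ne_zero
    rw [hf]
    push_cast
    field_simp
    ring

/-- The Bernoulli polynomial is bounded on `[0, 1]`, and a nonpositive real exponent makes `(x + t)
^ (-(σ + k))`, with `σ = Re s`, largest at `t = 0`. -/
theorem exists_norm_emInt_le (k : ℕ) : ∃ M : ℝ, 0 ≤ M ∧ ∀ (s : ℂ) (x : ℕ), 1 ≤ x →
    0 ≤ s.re + k → ‖emInt k s x‖ ≤ M * (x : ℝ) ^ (-(s.re + k)) := by
  obtain ⟨M, hM⟩ := isCompact_Icc.exists_bound_of_continuousOn (s := Set.Icc (0 : ℝ) 1)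
    (continuous_bernoulliFun k).continuousOn
  refine ⟨M, (norm_nonneg _).trans (hM 0 (by simp)), fun s x hx hs => ?_⟩
  have hx0 : (0 : ℝ) < x := by exact_mod_cast hx
  have h := intervalIntegral.norm_integral_le_of_norm_le_const (a := (0 : ℝ)) (b := 1)
    (f := fun t => (((x : ℝ) + t : ℝ) : ℂ) ^ (-(s + k)) * (bernoulliFun k t : ℂ))
    (C := M * (x : ℝ) ^ (-(s.re + k))) fun t ht => by
      rw [Set.uIoc_of_le zero_le_one] at ht
      have ht' : t ∈ Set.Icc (0 : ℝ) 1 := ⟨ht.1.le, ht.2⟩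
      rw [norm_mul, Complex.norm_cpow_eq_rpow_re_of_pos (by linarith [ht.1]), mul_comm,
        Complex.norm_real]
      refine mul_le_mul (hM t ht') ?_ (Real.rpow_nonneg (by linarith [ht.1]) _)
        ((norm_nonneg _).trans (hM t ht'))
      simp only [Complex.neg_re, Complex.add_re, Complex.natCast_re]
      exact Real.rpow_le_rpow_of_nonpos hx0 (by linarith [ht.1]) (by linarith)
  simpa [emInt] using h

theorem exists_norm_emStep_le (K : ℕ) : ∃ M : ℝ, 0 ≤ M ∧ ∀ (s : ℂ) (x : ℕ), 1 ≤ x → s ≠ 1 →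
    0 ≤ s.re + (K + 1) →
      ‖emStep K s x‖ ≤ M * ‖rising (K + 1) s‖ * (x : ℝ) ^ (-(s.re + (K + 1))) := by
  obtain ⟨M, hM0, hM⟩ := exists_norm_emInt_le (K + 1)
  refine ⟨M / (K + 1).factorial, by positivity, fun s x hx hs h => ?_⟩
  rw [emStep_eq hx hs, norm_neg, norm_mul, norm_div, Complex.norm_natCast]
  have := hM s x hx (by push_cast; exact h)
  push_cast at this
  calc _ ≤ ‖rising (K + 1) s‖ / (K + 1).factorial *
        (M * (x : ℝ) ^ (-(s.re + (K + 1)))) := by gcongr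
    _ = _ := by ring

theorem differentiable_rising (k : ℕ) : Differentiable ℂ (rising k) := by
  unfold rising
  fun_prop

theorem differentiableAt_emCoeff (i : ℕ) {s : ℂ} (hs : s ≠ 1) :
    DifferentiableAt ℂ (emCoeff i) s := by
  cases i with
  | zero => exact (differentiableAt_id.sub_const 1).inv (sub_ne_zero.2 hs)
  | succ k => exact ((differentiable_rising k s).mul_const _).div_const _

theorem differentiableAt_emMain (K : ℕ) {s : ℂ} (hs : s ≠ 1) {x : ℕ} (hx : 1 ≤ x) :
    DifferentiableAt ℂ (fun s => emMain K s x) s := by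
  unfold emMain
  refine DifferentiableAt.fun_sum fun i _ => (differentiableAt_emCoeff i hs).mul ?_
  exact differentiableAt_natCast_cpow_neg hx (by fun_prop)

theorem differentiableAt_emStep (K : ℕ) {s : ℂ} (hs : s ≠ 1) {x : ℕ} (hx : 1 ≤ x) :
    DifferentiableAt ℂ (fun s => emStep K s x) s :=
  (differentiableAt_natCast_cpow_neg (by omega) differentiableAt_id).sub
    ((differentiableAt_emMain K hs hx).sub (differentiableAt_emMain K hs (by omega)))

section Tame

variable {E : Type*} [NormedAddCommGroup E] [NormedSpace ℂ E] {e₀ : E}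

theorem tameAt_emStep (K : ℕ) {c : E → ℂ} (hc : ∀ᶠ e in 𝓝 e₀, DifferentiableAt ℂ c e)
    (h1 : c e₀ ≠ 1) (hK : 0 < (c e₀).re + (K + 1)) :
    TameAt e₀ (fun x e => emStep K (c e) x) ((c e₀).re + (K + 1)) where
  diff := by
    filter_upwards [hc, hc.self_of_nhds.continuousAt.eventually_ne h1] with e he he1 u hu
    exact (differentiableAt_emStep K he1 hu).comp e he
  bound ρ' hρ' := by
    obtain ⟨M, hM0, hM⟩ := exists_norm_emStep_le K
    have hcc := hc.self_of_nhds.continuousAt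
    have hre : ContinuousAt (fun e => (c e).re) e₀ := Complex.continuous_re.continuousAt.comp hcc
    have hP : ContinuousAt (fun e => ‖rising (K + 1) (c e)‖) e₀ :=
      ((differentiable_rising (K + 1)).continuous.continuousAt.comp hcc).norm
    refine ⟨M * (‖rising (K + 1) (c e₀)‖ + 1), ?_⟩
    filter_upwards [hcc.eventually_ne h1,
      hre.eventually_const_lt (show max (-(K + 1 : ℝ)) (ρ' - (K + 1)) < (c e₀).re from
        max_lt (by linarith) (by linarith)),
      hP.eventually_lt_const (lt_add_one _)] with e he1 he2 he3 u hu
    have h4 := (le_max_left _ _).trans he2.le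
    have h5 := (le_max_right _ _).trans he2.le
    refine (hM (c e) u hu he1 (by linarith)).trans ?_
    exact mul_le_mul (mul_le_mul_of_nonneg_left he3.le hM0)
      (rpow_neg_le_rpow_neg hu (by linarith)) (by positivity) (by positivity)

/-- The summands have order `Re s + K + 1`, and the summation loses one. The half-plane `Re s > -K`
reaches far beyond the convergence of `∑ y ^ (-s)`. -/
theorem tameAt_emRem (K : ℕ) {c : E → ℂ} (hc : ∀ᶠ e in 𝓝 e₀, DifferentiableAt ℂ c e)
    (h1 : c e₀ ≠ 1) (hK : 0 < (c e₀).re + K) :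
    TameAt e₀ (fun x e => emRem K (c e) x) ((c e₀).re + K) :=
  ((tameAt_emStep K hc h1 (by linarith)).tailSeries (by linarith)).mono (by linarith)

end Tame

theorem decay_emStep (K : ℕ) {s : ℂ} (hs : s ≠ 1) (hK : 0 < s.re + (K + 1)) :
    Decay (emStep K s) (s.re + (K + 1)) :=
  (tameAt_emStep (e₀ := s) K (c := fun s => s) (Eventually.of_forall fun _ => differentiableAt_id)
    hs hK).decay

theorem decay_emRem (K : ℕ) {s : ℂ} (hs : s ≠ 1) (hK : 0 < s.re + K) :
    Decay (emRem K s) (s.re + K) :=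
  (tameAt_emRem (e₀ := s) K (c := fun s => s) (Eventually.of_forall fun _ => differentiableAt_id)
    hs hK).decay

theorem decay_cpow (w : ℂ) : Decay (fun x => (x : ℂ) ^ (-w)) w.re := by
  simpa using decay_one.cpow_mul w

theorem decay_emMain (K : ℕ) (s : ℂ) : Decay (emMain K s) (s.re - 1) := by
  refine Decay.sum _ fun i _ => Decay.const_mul _ ((decay_cpow _).mono ?_)
  simp

theorem tailSeries_add {φ ψ : ℕ → ℂ} {u : ℕ} (h : Summable fun n => φ (u + n))
    (h' : Summable fun n => ψ (u + n)) :
    tailSeries (fun x => φ x + ψ x) u = tailSeries φ u + tailSeries ψ u :=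
  h.tsum_add h'

theorem Decay.shift {φ : ℕ → ℂ} {ρ : ℝ} (h : Decay φ ρ) : Decay (fun u => φ (u + 1)) ρ :=
  (TameAt.shift (e₀ := (0 : ℂ)) h.tameAt).decay

/-- Sum the definition of `emStep` over all steps: the differences of `emMain` telescope, and for
`Re s > 1` their boundary value at infinity is `0`. -/
theorem nest_one_eq {s : ℂ} (hs : 1 < s.re) (K : ℕ) {x : ℕ} (hx : 1 ≤ x) :
    nest s (fun _ => 1) x = emMain K s x + emRem K s x := by
  have hs1 : s ≠ 1 := fun h => by simp [h] at hs
  have hK : (0 : ℝ) ≤ K := by positivity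
  have h1 : Summable fun n => emStep K s (x + n) :=
    ((decay_emStep K hs1 (by linarith)).summable_tail (by linarith) hx).of_norm
  have h2 : Summable fun n => ((x + n + 1 : ℕ) : ℂ) ^ (-s) :=
    ((decay_cpow s).shift.summable_tail hs hx).of_norm
  have h3 : Summable fun n => emMain K s (x + n) - emMain K s (x + n + 1) := by
    refine (h2.sub h1).congr fun n => ?_
    rw [emStep]
    ring
  have h4 := tailSeries_sub_succ (D := emMain K s) h3
    ((decay_emMain K s).tendsto_zero (by linarith))
  have h5 := tailSeries_add (φ := fun y => emMain K s y - emMain K s (y + 1))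
    (ψ := emStep K s) h3 h1
  rw [h4] at h5
  rw [emRem, ← h5, nest, tailSeries, tailSeries]
  refine tsum_congr fun n => ?_
  rw [emStep, mul_one, add_right_comm]
  push_cast
  ring

/-- Two consecutive expansions differ by one telescoping term that tends to `0` already for `Re s >
-K - 1`. Hence the continuation will not depend on `K`, even where the original series diverges. -/
theorem emRem_eq_succ {s : ℂ} (hs : s ≠ 1) {K : ℕ} (hK : 0 < s.re + K) {x : ℕ} (hx : 1 ≤ x) :
    emRem K s x = emCoeff (K + 2) s * (x : ℂ) ^ (-(s - 1 + (K + 2 : ℕ))) + emRem (K + 1) s x := by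
  have hw : s - 1 + ((K + 2 : ℕ) : ℂ) = s + (K + 1) := by push_cast; ring
  rw [hw]
  set D : ℕ → ℂ := fun x => emCoeff (K + 2) s * (x : ℂ) ^ (-(s + (K + 1))) with hD
  have hstep : ∀ x, emStep K s x = D x - D (x + 1) + emStep (K + 1) s x := fun x => by
    simp only [emStep, emMain_succ, hD]
    ring
  have h1 : Summable fun n => emStep K s (x + n) :=
    ((decay_emStep K hs (by linarith)).summable_tail (by linarith) hx).of_norm
  have h2 : Summable fun n => emStep (K + 1) s (x + n) :=
    ((decay_emStep (K + 1) hs (by push_cast; linarith)).summable_tail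
      (by push_cast; linarith) hx).of_norm
  have h3 : Summable fun n => D (x + n) - D (x + n + 1) := by
    refine (h1.sub h2).congr fun n => ?_
    rw [hstep]
    ring
  have hDt : Tendsto D atTop (𝓝 0) := by
    refine (Decay.const_mul _ (decay_cpow _)).tendsto_zero ?_
    simp
    linarith
  have h4 := tailSeries_add (φ := fun y => D y - D (y + 1)) (ψ := emStep (K + 1) s) h3 h2
  rw [tailSeries_sub_succ (D := D) h3 hDt] at h4
  rw [emRem, emRem]
  simp only [hD] at h4
  rw [← h4]
  exact tsum_congr fun n => by rw [hstep]

theorem rising_neg_natCast {m k : ℕ} (h : m < k) : rising k (-(m : ℂ)) = 0 :=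
  Finset.prod_eq_zero (Finset.mem_range.2 h) (by ring)

theorem neg_natCast_ne_one (m : ℕ) : -(m : ℂ) ≠ 1 := by
  intro h
  have := congrArg Complex.re h
  simp at this
  have h2 : (0 : ℝ) ≤ m := by positivity
  linarith

/-- The factor `s (s + 1) ⋯ (s + K)` of the step vanishes at `s = -m` for `m ≤ K`: Euler–Maclaurin
is exact for polynomials. This is the source of the finite recurrence. -/
theorem emStep_neg_natCast {m K : ℕ} (h : m ≤ K) {x : ℕ} (hx : 1 ≤ x) :
    emStep K (-(m : ℂ)) x = 0 := by
  rw [emStep_eq hx (neg_natCast_ne_one m), rising_neg_natCast (by omega)]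
  simp

theorem emRem_neg_natCast {m K : ℕ} (h : m ≤ K) {x : ℕ} (hx : 1 ≤ x) :
    emRem K (-(m : ℂ)) x = 0 := by
  rw [emRem, tailSeries]
  exact (tsum_congr fun n => emStep_neg_natCast h (by omega)).trans tsum_zero

/-! ### The values of the coefficients at non-positive integers -/

/-- The coefficients of the formal combination `absorb`. -/
def absorbCoeff (m : ℕ) : ℕ → ℚ
  | 0 => -1 / ((m : ℚ) + 1)
  | k + 1 => (m.choose k : ℚ) * zetaNeg k

theorem absorb_eq (ι : ℤ → List ℤ) (a : ℤ) (m : ℕ) :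
    absorb ι a m = ∑ i ∈ Finset.range (m + 2),
      Finsupp.single (ι (a - (m + 1) + i)) (absorbCoeff m i) := by
  rw [Finset.sum_range_succ', absorb, add_comm]
  congr 1
  · refine Finset.sum_congr rfl fun k _ => ?_
    have : a - (m + 1) + ((k + 1 : ℕ) : ℤ) = a - m + k := by push_cast; ring
    rw [this]
    rfl
  · have : a - (m + 1) + ((0 : ℕ) : ℤ) = a - m - 1 := by push_cast; ring
    rw [this]
    rfl

theorem rising_neg_natCast_eq (m k : ℕ) :
    rising k (-(m : ℂ)) = (-1) ^ k * (m.descFactorial k : ℂ) := by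
  induction k with
  | zero => simp [rising]
  | succ k ih =>
    rw [rising_succ, ih, Nat.descFactorial_succ]
    rcases le_or_gt k m with h | h
    · push_cast [Nat.cast_sub h]; ring
    · rw [Nat.descFactorial_eq_zero_iff_lt.2 h]; simp

/-- The numbers in the recurrence are the Euler–Maclaurin coefficients at `-m`, by `ζ(-k) =
-B'_{k+1} / (k+1)`. The sign `(-1) ^ k` of the rising factorial passes between the two conventions
for Bernoulli numbers. -/
theorem emCoeff_neg_natCast (m i : ℕ) : emCoeff i (-(m : ℂ)) = (absorbCoeff m i : ℂ) := by
  cases i with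
  | zero =>
    have : (-(m : ℂ) - 1) = -((m : ℂ) + 1) := by ring
    rw [emCoeff, absorbCoeff, this]
    push_cast
    rw [inv_neg, neg_div, one_div]
  | succ k =>
    rw [emCoeff, absorbCoeff, zetaNeg, rising_neg_natCast_eq, bernoulli'_eq_bernoulli,
      Nat.descFactorial_eq_factorial_mul_choose, Nat.factorial_succ]
    have h1 : (k.factorial : ℂ) ≠ 0 := by exact_mod_cast k.factorial_ne_zero
    have h2 : (k : ℂ) + 1 ≠ 0 := by exact_mod_cast k.succ_ne_zero
    push_cast
    field_simp
    ring

theorem absorbCoeff_eq_zero_of_lt {m i : ℕ} (h : m + 1 < i) : absorbCoeff m i = 0 := by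
  cases i with
  | zero => omega
  | succ k => rw [absorbCoeff, Nat.choose_eq_zero_of_lt (by omega)]; simp

theorem emCoeff_eq_zero_of_odd {i : ℕ} (h : Odd i) (hi : 1 < i) (s : ℂ) : emCoeff i s = 0 := by
  cases i with
  | zero => omega
  | succ k => rw [emCoeff, bernoulli_eq_zero_of_odd h hi]; simp

theorem absorbCoeff_eq_zero_of_odd {m i : ℕ} (h : Odd i) (hi : 1 < i) : absorbCoeff m i = 0 := by
  have := emCoeff_eq_zero_of_odd h hi (-(m : ℂ))
  rw [emCoeff_neg_natCast] at this
  exact_mod_cast this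

/-- Faulhaber's formula: `∑ i, absorbCoeff m i · x ^ (m + 1 - i)` is `ζ(-m) - ∑_{k=1}^{x} k ^ m`. -/
theorem sum_absorbCoeff (m x : ℕ) :
    ∑ i ∈ Finset.range (m + 2), absorbCoeff m i * (x : ℚ) ^ (m + 1 - i) =
      zetaNeg m - ∑ k ∈ Finset.Ico 1 (x + 1), (k : ℚ) ^ m := by
  -- The terms `i = 0` and `i = m + 1` are split off. The latter is the constant `ζ(-m)`, which has
  -- no counterpart in the power sum.
  rw [sum_Ico_pow, Finset.sum_range_succ', Finset.sum_range_succ, Finset.sum_range_succ']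
  have h0 : (m : ℚ) + 1 ≠ 0 := by positivity
  have h : ∀ k ∈ Finset.range m, absorbCoeff m (k + 1) * (x : ℚ) ^ (m + 1 - (k + 1)) =
      -(bernoulli' (k + 1) * ((m + 1).choose (k + 1) : ℚ) * (x : ℚ) ^ (m + 1 - (k + 1)) /
        (m + 1)) := by
    intro k _
    have h1 : ((m + 1 : ℕ) : ℚ) * (m.choose k : ℚ) =
        ((m + 1).choose (k + 1) : ℚ) * (k + 1 : ℕ) := by
      exact_mod_cast Nat.add_one_mul_choose_eq m k
    have h2 : (k : ℚ) + 1 ≠ 0 := by positivity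
    push_cast at h1
    rw [absorbCoeff, zetaNeg]
    field_simp
    linear_combination (-1 : ℚ) * (x : ℚ) ^ (m + 1 - (k + 1)) * bernoulli' (k + 1) * h1
  rw [Finset.sum_congr rfl h, Finset.sum_neg_distrib]
  simp only [absorbCoeff, Nat.choose_self, Nat.cast_one, one_mul, Nat.sub_self, pow_zero, mul_one,
    Nat.sub_zero, bernoulli'_zero, Nat.choose_zero_right]
  ring

/-! ### Conditions on the tail sums of a list -/

/-- `P k w` holds for the length `k` and the sum `w` of every nonempty tail of the list. -/
def TailAll (P : ℕ → ℂ → Prop) : List ℂ → Prop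
  | [] => True
  | a :: l => P (l.length + 1) (a + l.sum) ∧ TailAll P l

theorem tailSum_succ {r : ℕ} (s : Fin (r + 1) → ℂ) {k : ℕ} (hk : k ≤ r) :
    tailSum s k = tailSum (fun i => s i.succ) k := by
  rw [tailSum, Fin.sum_univ_succ, if_neg (by simp; omega), zero_add, tailSum]
  refine Finset.sum_congr rfl fun i _ => ?_
  simp only [Fin.val_succ]
  exact if_congr (by omega) rfl rfl

theorem tailSum_self {r : ℕ} (s : Fin r → ℂ) : tailSum s r = (List.ofFn s).sum := by
  rw [tailSum, List.sum_ofFn]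
  exact Finset.sum_congr rfl fun i _ => if_pos (by omega)

/-- This links the recursion on lists with `tailSum`, so that regularity and convergence can be
proved by induction along the list. -/
theorem tailAll_ofFn (P : ℕ → ℂ → Prop) {r : ℕ} (s : Fin r → ℂ) :
    TailAll P (List.ofFn s) ↔ ∀ k, 1 ≤ k → k ≤ r → P k (tailSum s k) := by
  induction r with
  | zero =>
    simp only [List.ofFn_zero, TailAll, true_iff]
    intro k h1 h2
    omega
  | succ r ih =>
    have h0 : s 0 + (List.ofFn fun i : Fin r => s i.succ).sum = tailSum s (r + 1) := by
      rw [tailSum_self, List.ofFn_succ, List.sum_cons]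
    rw [List.ofFn_succ, TailAll, ih, List.length_ofFn, h0]
    constructor
    · rintro ⟨h1, h2⟩ k hk hkr
      rcases Nat.lt_or_ge r k with h | h
      · obtain rfl : k = r + 1 := by omega
        exact h1
      · rw [tailSum_succ s h]
        exact h2 k hk h
    · intro h
      refine ⟨h _ (by omega) le_rfl, fun k hk hkr => ?_⟩
      rw [← tailSum_succ s hkr]
      exact h k hk (by omega)

/-- The sum `w` of a tail of length `k` violates the condition of regularity. -/
def IsBad (k : ℕ) (w : ℂ) : Prop :=
  (k = 1 ∧ w = 1) ∨ (k = 2 ∧ (w = 2 ∨ w = 1 ∨ ∃ j : ℕ, w = -2 * (j : ℂ))) ∨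
    (3 ≤ k ∧ ∃ z : ℤ, z ≤ (k : ℤ) ∧ w = (z : ℂ))

/-- No tail sum is singular. -/
def Regular : List ℂ → Prop := TailAll fun k w => ¬IsBad k w

/-- The condition for the absolute convergence of an iterated sum whose innermost function
is of order `ρ`. -/
def Conv (ρ : ℝ) : List ℂ → Prop := TailAll fun k w => (k : ℝ) < w.re + ρ

theorem mem_convergenceRegion_iff {r : ℕ} (s : Fin r → ℂ) :
    s ∈ convergenceRegion r ↔ Conv 0 (List.ofFn s) := by
  rw [Conv, tailAll_ofFn]
  simp [convergenceRegion]

theorem mem_singularSet_iff {r : ℕ} (s : Fin r → ℂ) :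
    s ∈ singularSet r ↔ ¬Regular (List.ofFn s) := by
  rw [Regular, tailAll_ofFn]
  push Not
  constructor
  · rintro (⟨h1, h2⟩ | ⟨h1, h2⟩ | ⟨k, h1, h2, h3⟩)
    · exact ⟨1, le_rfl, h1, Or.inl ⟨rfl, h2⟩⟩
    · exact ⟨2, by omega, h1, Or.inr (Or.inl ⟨rfl, h2⟩)⟩
    · exact ⟨k, by omega, h2, Or.inr (Or.inr ⟨h1, h3⟩)⟩
  · rintro ⟨k, h1, h2, ⟨rfl, h3⟩ | ⟨rfl, h3⟩ | ⟨h3, h4⟩⟩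
    · exact Or.inl ⟨h2, h3⟩
    · exact Or.inr (Or.inl ⟨h2, h3⟩)
    · exact Or.inr (Or.inr ⟨k, h3, h2, h4⟩)

theorem conv_cons {ρ : ℝ} {a : ℂ} {l : List ℂ} :
    Conv ρ (a :: l) ↔ ((l.length : ℝ) + 1 < a.re + l.sum.re + ρ) ∧ Conv ρ l := by
  simp [Conv, TailAll]

theorem conv_nil (ρ : ℝ) : Conv ρ [] := trivial

/-- For the entries of `A`, the iterated sum over `t` acts as an innermost function whose order has
changed by `Re (∑ t) - |t|`. -/
theorem conv_append {ρ : ℝ} {A t : List ℂ} :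
    Conv ρ (A ++ t) ↔ Conv (ρ + t.sum.re - t.length) A ∧ Conv ρ t := by
  induction A with
  | nil => simp [conv_nil]
  | cons a A ih =>
    rw [List.cons_append, conv_cons, conv_cons, ih, and_assoc]
    refine and_congr_left fun _ => ?_
    rw [List.length_append, List.sum_append, Complex.add_re]
    push_cast
    constructor <;> intro h <;> linarith

theorem Conv.mono {ρ σ : ℝ} {l : List ℂ} (h : Conv ρ l) (hσ : ρ ≤ σ) : Conv σ l := by
  induction l with
  | nil => trivial
  | cons a l ih =>
    rw [conv_cons] at h ⊢
    exact ⟨by linarith, ih h.2⟩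

/-! ### Iterated sums -/

/-- `∑_{u < x₁ < ⋯ < x_r} x₁ ^ (-l₁) ⋯ x_r ^ (-l_r) φ(x_r)`. -/
def nestList (l : List ℂ) (φ : ℕ → ℂ) : ℕ → ℂ := l.foldr nest φ

theorem nestList_cons (a : ℂ) (l : List ℂ) (φ : ℕ → ℂ) :
    nestList (a :: l) φ = nest a (nestList l φ) := rfl

theorem nestList_append (A t : List ℂ) (φ : ℕ → ℂ) :
    nestList (A ++ t) φ = nestList A (nestList t φ) := List.foldr_append ..

theorem nestList_singleton (a : ℂ) (φ : ℕ → ℂ) : nestList [a] φ = nest a φ := rfl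

theorem Decay.nestList {φ : ℕ → ℂ} {ρ : ℝ} (h : Decay φ ρ) {l : List ℂ} (hl : Conv ρ l) :
    Decay (nestList l φ) (l.sum.re + ρ - l.length) := by
  induction l with
  | nil => simpa [EulerZagier.nestList] using h
  | cons a l ih =>
    rw [conv_cons] at hl
    refine ((ih hl.2).nest (a := a) (by linarith)).mono (le_of_eq ?_)
    simp
    ring

theorem nest_congr {φ ψ : ℕ → ℂ} (h : ∀ u ≥ 1, φ u = ψ u) (a : ℂ) : nest a φ = nest a ψ := by
  funext u
  refine tsum_congr fun n => ?_
  simp only [h (u + 1 + n) (by omega)]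

/-- A nested sum evaluates `φ` only at arguments `≥ 1`. For the empty list the argument is `u`
itself, whence the side condition. -/
theorem nestList_congr {φ ψ : ℕ → ℂ} (h : ∀ u ≥ 1, φ u = ψ u) (l : List ℂ) {u : ℕ}
    (hu : l ≠ [] ∨ 1 ≤ u) : nestList l φ u = nestList l ψ u := by
  induction l generalizing u with
  | nil => exact h u (by simpa using hu)
  | cons a l ih => exact congrFun (nest_congr (fun v hv => ih (Or.inr hv)) a) u

theorem nest_const_mul (a c : ℂ) (φ : ℕ → ℂ) :
    nest a (fun x => c * φ x) = fun u => c * nest a φ u := by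
  funext u
  rw [nest, nest, tailSeries, tailSeries, ← tsum_mul_left]
  exact tsum_congr fun n => by ring

theorem nestList_const_mul (l : List ℂ) (c : ℂ) (φ : ℕ → ℂ) :
    nestList l (fun x => c * φ x) = fun u => c * nestList l φ u := by
  induction l with
  | nil => rfl
  | cons a l ih => rw [nestList_cons, ih, nest_const_mul, nestList_cons]

theorem nest_add {φ ψ : ℕ → ℂ} {ρ : ℝ} (hφ : Decay φ ρ) (hψ : Decay ψ ρ) {a : ℂ}
    (ha : 1 < a.re + ρ) : nest a (fun x => φ x + ψ x) = fun u => nest a φ u + nest a ψ u := by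
  funext u
  simp only [nest, mul_add]
  exact tailSeries_add (φ := fun x => (x : ℂ) ^ (-a) * φ x) (ψ := fun x => (x : ℂ) ^ (-a) * ψ x)
    (hφ.summable_nest ha u).of_norm (hψ.summable_nest ha u).of_norm

theorem nestList_add {φ ψ : ℕ → ℂ} {ρ : ℝ} (hφ : Decay φ ρ) (hψ : Decay ψ ρ) {l : List ℂ}
    (hl : Conv ρ l) :
    nestList l (fun x => φ x + ψ x) = fun u => nestList l φ u + nestList l ψ u := by
  induction l with
  | nil => rfl
  | cons a l ih =>
    rw [conv_cons] at hl
    rw [nestList_cons, ih hl.2, nest_add (hφ.nestList hl.2) (hψ.nestList hl.2) (by linarith)]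
    rfl

theorem nest_zero (a : ℂ) : nest a (fun _ => 0) = fun _ => 0 := by
  funext u
  simp [nest, tailSeries]

theorem nestList_zero (l : List ℂ) : nestList l (fun _ => 0) = fun _ => 0 := by
  induction l with
  | nil => rfl
  | cons a l ih => rw [nestList_cons, ih, nest_zero]

theorem nestList_sum {ι : Type*} (s : Finset ι) (c : ι → ℂ) {φ : ι → ℕ → ℂ} {ρ : ℝ}
    (hφ : ∀ i ∈ s, Decay (φ i) ρ) {l : List ℂ} (hl : Conv ρ l) :
    nestList l (fun x => ∑ i ∈ s, c i * φ i x) = fun u => ∑ i ∈ s, c i * nestList l (φ i) u := by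
  classical
  induction s using Finset.induction_on with
  | empty => simp [nestList_zero]
  | insert i s hi ih =>
    have h1 : ∀ j ∈ s, Decay (φ j) ρ := fun j hj => hφ j (by simp [hj])
    have h2 := ih h1
    simp only [Finset.sum_insert hi]
    rw [nestList_add ((hφ i (by simp)).const_mul _)
      (Decay.sum s fun j hj => (h1 j hj).const_mul _) hl, h2, nestList_const_mul]

/-- This merges two variables into one: a power left by the summation over `y > x` joins the
exponent of `x`. -/
theorem nest_cpow_mul (a w : ℂ) (φ : ℕ → ℂ) :
    nest a (fun x => (x : ℂ) ^ (-w) * φ x) = nest (a + w) φ := by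
  funext u
  refine tsum_congr fun n => ?_
  have h : ((u + 1 + n : ℕ) : ℂ) ≠ 0 := by exact_mod_cast (by omega : u + 1 + n ≠ 0)
  simp only [← mul_assoc, ← Complex.cpow_add _ _ h, neg_add]

theorem nest_pow_mul (a : ℂ) (j : ℕ) (φ : ℕ → ℂ) :
    nest a (fun x => (x : ℂ) ^ j * φ x) = nest (a - j) φ := by
  rw [sub_eq_add_neg, ← nest_cpow_mul]
  simp

theorem Decay.pow_mul {φ : ℕ → ℂ} {ρ : ℝ} (h : Decay φ ρ) (j : ℕ) :
    Decay (fun x => (x : ℂ) ^ j * φ x) (ρ - j) := by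
  refine (h.cpow_mul (-(j : ℂ))).congr (fun u _ => by simp) |>.mono (le_of_eq ?_)
  simp
  ring

section Tame

variable {E : Type*} [NormedAddCommGroup E] [NormedSpace ℂ E] {e₀ : E}

theorem TameAt.nestList {Φ : ℕ → E → ℂ} {ρ : ℝ} (h : TameAt e₀ Φ ρ) {L : List (E → ℂ)}
    (hL : ∀ a ∈ L, ∀ᶠ e in 𝓝 e₀, DifferentiableAt ℂ a e) (hc : Conv ρ (L.map fun a => a e₀)) :
    TameAt e₀ (fun u e => nestList (L.map fun a => a e) (fun x => Φ x e) u)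
      ((L.map fun a : E → ℂ => a e₀).sum.re + ρ - L.length) := by
  induction L with
  | nil => simpa [EulerZagier.nestList] using h
  | cons a L ih =>
    rw [List.map_cons, conv_cons, List.length_map] at hc
    have h1 := ih (fun b hb => hL b (by simp [hb])) hc.2
    refine (h1.nest (hL a (by simp)) (by linarith)).mono (le_of_eq ?_)
    simp
    ring

theorem TameAt.differentiableAt_nestList {Φ : ℕ → E → ℂ} {ρ : ℝ} (h : TameAt e₀ Φ ρ)
    {L : List (E → ℂ)} (hL : ∀ a ∈ L, ∀ᶠ e in 𝓝 e₀, DifferentiableAt ℂ a e)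
    (hc : Conv ρ (L.map fun a => a e₀)) (hne : L ≠ []) (u : ℕ) :
    DifferentiableAt ℂ
      (fun e => EulerZagier.nestList (L.map fun a => a e) (fun x => Φ x e) u) e₀ := by
  cases L with
  | nil => exact absurd rfl hne
  | cons a L =>
    rw [List.map_cons, conv_cons, List.length_map] at hc
    exact (h.nestList (fun b hb => hL b (by simp [hb])) hc.2).differentiableAt_nest
      (hL a (by simp)) (by linarith) u

end Tame

/-! ### Iterated sums as sums over chains -/

/-- Strictly increasing sequences of integers `> u`. -/
abbrev ChainFrom (u r : ℕ) : Type := {x : Fin r → ℕ // StrictMono x ∧ ∀ i, u < x i}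

/-- Splitting off the smallest member of a chain. -/
def chainFromEquiv (u r : ℕ) : (Σ n : ℕ, ChainFrom (u + 1 + n) r) ≃ ChainFrom u (r + 1) where
  toFun p := ⟨Fin.cons (u + 1 + p.1) p.2.1, by
    refine ⟨?_, fun i => ?_⟩
    · rw [Fin.strictMono_iff_lt_succ]
      intro i
      cases r with
      | zero => exact i.elim0
      | succ r =>
        refine Fin.cases ?_ (fun i => ?_) i
        · simpa using p.2.2.2 0
        · simpa using p.2.2.1 (Fin.castSucc_lt_succ (i := i))
    · refine Fin.cases ?_ (fun i => ?_) i
      · simp only [Fin.cons_zero]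
        omega
      · have := p.2.2.2 i
        simp only [Fin.cons_succ]
        omega⟩
  invFun x := ⟨x.1 0 - (u + 1), ⟨fun i => x.1 i.succ, by
    refine ⟨fun i j h => x.2.1 (Fin.succ_lt_succ_iff.2 h), fun i => ?_⟩
    have h1 := x.2.2 0
    have h2 := x.2.1 (Fin.succ_pos i)
    simp only
    omega⟩⟩
  left_inv p := by
    obtain ⟨n, y, hy⟩ := p
    have : u + 1 + n - (u + 1) = n := by omega
    simp only [Fin.cons_succ]
    congr!
  right_inv x := by
    refine Subtype.ext (funext fun i => ?_)
    have h1 := x.2.2 0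
    refine Fin.cases ?_ (fun i => ?_) i
    · simp only [Fin.cons_zero]
      omega
    · rfl

/-- The general term of the multiple zeta series. -/
def chainTerm {r : ℕ} (s : Fin r → ℂ) {u : ℕ} (x : ChainFrom u r) : ℂ :=
  ∏ i, (x.1 i : ℂ) ^ (-(s i))

theorem chainTerm_chainFromEquiv {r : ℕ} (s : Fin (r + 1) → ℂ) (u n : ℕ)
    (y : ChainFrom (u + 1 + n) r) : chainTerm s (chainFromEquiv u r ⟨n, y⟩) =
      ((u + 1 + n : ℕ) : ℂ) ^ (-(s 0)) * chainTerm (fun i => s i.succ) y := by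
  simp [chainTerm, chainFromEquiv, Fin.prod_univ_succ]

/-- Absolute convergence at `s` thus becomes convergence at the real parts of `s`, so one induction
covers both. -/
theorem norm_chainTerm {r : ℕ} (s : Fin r → ℂ) {u : ℕ} (x : ChainFrom u r) :
    ((‖chainTerm s x‖ : ℝ) : ℂ) = chainTerm (fun i => ((s i).re : ℂ)) x := by
  rw [chainTerm, chainTerm, norm_prod, Complex.ofReal_prod]
  refine Finset.prod_congr rfl fun i _ => ?_
  have h := x.2.2 i
  rw [Complex.norm_natCast_cpow_of_pos (by omega), Complex.ofReal_cpow (by positivity)]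
  simp

theorem conv_ofFn_re {ρ : ℝ} {r : ℕ} {s : Fin r → ℂ} (h : Conv ρ (List.ofFn s)) :
    Conv ρ (List.ofFn fun i => ((s i).re : ℂ)) := by
  induction r with
  | zero => simp [conv_nil]
  | succ r ih =>
    rw [List.ofFn_succ, conv_cons] at h ⊢
    refine ⟨?_, ih h.2⟩
    have h1 := h.1
    simp only [List.sum_ofFn, List.length_ofFn, Complex.re_sum, Complex.ofReal_re] at h1 ⊢
    exact h1

theorem decay_nestList_one {l : List ℂ} (hl : Conv 0 l) :
    Decay (nestList l fun _ => 1) (l.sum.re - l.length) := by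
  simpa using decay_one.nestList hl

/-- Split off the smallest variable and apply Fubini. Absolute summability comes from the induction
hypothesis at the real parts, combined with the decay of the inner iterated sum. -/
theorem hasSum_chainTerm {r : ℕ} {s : Fin r → ℂ} (h : Conv 0 (List.ofFn s)) (u : ℕ) :
    HasSum (fun x : ChainFrom u r => chainTerm s x) (nestList (List.ofFn s) (fun _ => 1) u) := by
  induction r generalizing u with
  | zero =>
    have : Unique (ChainFrom u 0) :=
      { default := ⟨Fin.elim0, fun i => i.elim0, fun i => i.elim0⟩
        uniq := fun x => Subtype.ext (Subsingleton.elim _ _) }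
    convert hasSum_unique (fun x : ChainFrom u 0 => chainTerm s x) using 1
    simp [chainTerm, nestList]
  | succ r ih =>
    have hre := conv_ofFn_re h
    rw [List.ofFn_succ, conv_cons] at h hre
    have hnorm : ∀ v, HasSum (fun y : ChainFrom v r => ‖chainTerm (fun i => s i.succ) y‖)
        (nestList (List.ofFn fun i : Fin r => ((s i.succ).re : ℂ)) (fun _ => 1) v).re := by
      intro v
      have h1 := Complex.hasSum_re (ih hre.2 v)
      refine h1.congr_fun ?_
      intro y
      rw [← norm_chainTerm (fun i => s i.succ), Complex.ofReal_re]
    have hsum : Summable fun p : Σ n : ℕ, ChainFrom (u + 1 + n) r =>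
        ((u + 1 + p.1 : ℕ) : ℂ) ^ (-(s 0)) * chainTerm (fun i => s i.succ) p.2 := by
      refine Summable.of_norm ?_
      rw [summable_sigma_of_nonneg fun _ => norm_nonneg _]
      constructor
      · intro n
        simp only [norm_mul]
        exact (hnorm _).summable.mul_left _
      · simp only [norm_mul, tsum_mul_left, (hnorm _).tsum_eq]
        have h2 := (decay_nestList_one hre.2).summable_nest (a := ((s 0).re : ℂ)) (by
          have := hre.1
          linarith) u
        refine Summable.of_nonneg_of_le (fun n => ?_) (fun n => ?_) h2
        · refine mul_nonneg (norm_nonneg _) ?_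
          exact (hnorm _).nonneg fun _ => norm_nonneg _
        · rw [norm_mul, Complex.norm_natCast_cpow_of_pos (by omega),
            Complex.norm_natCast_cpow_of_pos (by omega)]
          simp only [Complex.neg_re, Complex.ofReal_re]
          exact mul_le_mul_of_nonneg_left ((le_abs_self _).trans (Complex.abs_re_le_norm _))
            (by positivity)
    rw [← (chainFromEquiv u r).hasSum_iff, List.ofFn_succ, nestList_cons]
    have hfun : ((fun x : ChainFrom u (r + 1) => chainTerm s x) ∘ chainFromEquiv u r) =
        fun p : Σ n : ℕ, ChainFrom (u + 1 + n) r =>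
          ((u + 1 + p.1 : ℕ) : ℂ) ^ (-(s 0)) * chainTerm (fun i => s i.succ) p.2 := by
      funext p
      obtain ⟨n, y⟩ := p
      rw [Function.comp_apply, chainTerm_chainFromEquiv]
    rw [hfun]
    have h3 : ∀ n : ℕ, HasSum (fun y : ChainFrom (u + 1 + n) r =>
        ((u + 1 + n : ℕ) : ℂ) ^ (-(s 0)) * chainTerm (fun i => s i.succ) y)
        (((u + 1 + n : ℕ) : ℂ) ^ (-(s 0)) *
          nestList (List.ofFn fun i : Fin r => s i.succ) (fun _ => 1) (u + 1 + n)) := fun n =>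
      (ih (s := fun i => s i.succ) h.2 (u + 1 + n)).mul_left _
    have h4 := HasSum.sigma hsum.hasSum h3
    have h5 : nest (s 0) (nestList (List.ofFn fun i : Fin r => s i.succ) fun _ => 1) u = _ :=
      h4.tsum_eq
    rw [h5]
    exact hsum.hasSum

/-! ### Regular lists -/

theorem IsBad.exists_int {k : ℕ} {w : ℂ} (h : IsBad k w) : ∃ z : ℤ, z ≤ k ∧ w = z := by
  rcases h with ⟨rfl, rfl⟩ | ⟨rfl, rfl | rfl | ⟨j, rfl⟩⟩ | ⟨-, h⟩
  · exact ⟨1, by simp, by simp⟩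
  · exact ⟨2, by simp, by simp⟩
  · exact ⟨1, by simp, by simp⟩
  · exact ⟨-2 * j, by push_cast; omega, by push_cast; ring⟩
  · exact h

/-- For tails of length at least three every integer up to the length is forbidden, so lengthening
by one leaves room for a shift by `d ≥ -1`. -/
theorem IsBad.succ_of_add {k : ℕ} (hk : 2 ≤ k) {w : ℂ} {d : ℤ} (hd : -1 ≤ d)
    (h : IsBad k (w + d)) : IsBad (k + 1) w := by
  obtain ⟨z, hz, hw⟩ := h.exists_int
  refine Or.inr (Or.inr ⟨by omega, z - d, by push_cast; omega, ?_⟩)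
  rw [Int.cast_sub, ← hw]
  ring

/-- The hypothesis forces `w = 2 - i`. For `i = 1` or `i` even this runs through exactly `1, 2, 0,
-2, -4, …`, the forbidden values in length two. Odd `i > 1` is excluded because those terms carry
the coefficient `B_i = 0`. -/
theorem IsBad.two_of_add {w : ℂ} {i : ℕ} (hi : ¬(Odd i ∧ 1 < i)) (h : IsBad 1 (w + (i - 1))) :
    IsBad 2 w := by
  have h1 : w = 2 - i := by
    rcases h with ⟨-, h⟩ | ⟨h, -⟩ | ⟨h, -⟩
    · linear_combination h
    · omega
    · omega
  refine Or.inr (Or.inl ⟨rfl, ?_⟩)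
  rcases Nat.even_or_odd' i with ⟨j, rfl | rfl⟩
  · rcases j with _ | j
    · left; simp [h1]
    · right; right; exact ⟨j, by rw [h1]; push_cast; ring⟩
  · obtain rfl : j = 0 := by
      by_contra hj
      exact hi ⟨⟨j, rfl⟩, by omega⟩
    right; left; rw [h1]; norm_num

theorem regular_nil : Regular [] := trivial

theorem regular_cons {a : ℂ} {l : List ℂ} :
    Regular (a :: l) ↔ ¬IsBad (l.length + 1) (a + l.sum) ∧ Regular l := Iff.rfl

theorem Regular.of_append {A t : List ℂ} (h : Regular (A ++ t)) : Regular t := by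
  induction A with
  | nil => exact h
  | cons a A ih => exact ih h.2

/-- Replacing a tail of a regular list by a tail that is one shorter. -/
theorem Regular.replace_tail {A t t' : List ℂ} (h : Regular (A ++ t)) (h' : Regular t')
    (hlen : t.length = t'.length + 1) (ht' : t' ≠ []) {d : ℤ} (hd : -1 ≤ d)
    (hsum : t'.sum = t.sum + d) : Regular (A ++ t') := by
  induction A with
  | nil => exact h'
  | cons a A ih =>
    rw [List.cons_append, regular_cons] at h ⊢
    refine ⟨fun hb => h.1 ?_, ih h.2⟩
    have h0 : 0 < t'.length := List.length_pos_iff.2 ht'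
    simp only [List.length_append, List.sum_append, hsum, hlen] at hb ⊢
    have e : a + (A.sum + (t.sum + (d : ℂ))) = a + (A.sum + t.sum) + d := by ring
    rw [e] at hb
    exact IsBad.succ_of_add (by omega) hd hb

theorem Regular.last_ne_one {A : List ℂ} {c : ℂ} (h : Regular (A ++ [c])) : c ≠ 1 := by
  rintro rfl
  exact h.of_append.1 (Or.inl ⟨rfl, by simp⟩)

theorem Regular.merge_last {A : List ℂ} {a c : ℂ} (h : Regular (A ++ [a, c])) {i : ℕ}
    (hi : ¬(Odd i ∧ 1 < i)) : Regular (A ++ [a + (c - 1 + i)]) := by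
  refine h.replace_tail ⟨fun hb => ?_, trivial⟩ rfl (by simp) (d := i - 1) (by omega)
    (by simp; ring)
  have e : a + (c - 1 + (i : ℂ)) + ([] : List ℂ).sum = a + [c].sum + (i - 1) := by
    simp only [List.sum_nil, List.sum_cons]
    ring
  rw [e] at hb
  exact h.of_append.1 (IsBad.two_of_add hi hb)

/-! ### Reduction of the depth by summation over the last variable -/

theorem conv_add_last {A : List ℂ} {a w : ℂ} :
    Conv 0 (A ++ [a + w]) ↔ Conv w.re (A ++ [a]) := by
  rw [conv_append, conv_append, conv_cons, conv_cons]
  simp only [List.length_nil, List.sum_nil, List.sum_cons, List.length_cons, Complex.add_re,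
    Complex.zero_re, Nat.cast_zero, conv_nil, and_true]
  have : (0 : ℝ) + (a.re + w.re + 0) - (0 + 1 : ℕ) = w.re + (a.re + 0) - (0 + 1 : ℕ) := by ring
  rw [this]
  refine and_congr_right fun _ => ?_
  constructor <;> intro h <;> linarith

theorem conv_append_pair {A : List ℂ} {a c : ℂ} (h : Conv 0 (A ++ [a, c])) :
    Conv (c.re - 1) (A ++ [a]) ∧ 1 < c.re := by
  have e : A ++ [a, c] = (A ++ [a]) ++ [c] := by simp
  rw [e, conv_append, conv_cons] at h
  simpa [conv_nil] using h

theorem nestList_cpow (A : List ℂ) (a w : ℂ) :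
    nestList (A ++ [a]) (fun x => (x : ℂ) ^ (-w)) = nestList (A ++ [a + w]) fun _ => 1 := by
  rw [nestList_append, nestList_append, nestList_singleton, nestList_singleton, ← nest_cpow_mul]
  simp

/-- The innermost sum is replaced by its Euler–Maclaurin expansion, and each power is merged with
the exponent `a`. -/
theorem nestList_append_pair {A : List ℂ} {a c : ℂ} (h : Conv 0 (A ++ [a, c])) (K : ℕ) (u : ℕ) :
    nestList (A ++ [a, c]) (fun _ => 1) u =
      ∑ i ∈ Finset.range (K + 2),
        emCoeff i c * nestList (A ++ [a + (c - 1 + i)]) (fun _ => 1) u +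
      nestList (A ++ [a]) (emRem K c) u := by
  obtain ⟨h1, h2⟩ := conv_append_pair h
  have hc : c ≠ 1 := fun h => by simp [h] at h2
  have hK : (0 : ℝ) ≤ K := by positivity
  have e : A ++ [a, c] = (A ++ [a]) ++ [c] := by simp
  rw [e, nestList_append, nestList_singleton,
    nestList_congr (fun x hx => nest_one_eq h2 K hx) _ (Or.inl (by simp)),
    nestList_add (decay_emMain K c) ((decay_emRem K hc (by linarith)).mono (by linarith)) h1]
  unfold emMain
  rw [nestList_sum (ρ := c.re - 1) _ _ (fun i _ => (decay_cpow _).mono (by simp)) h1]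
  simp only [nestList_cpow]

theorem nestList_emRem_succ {A : List ℂ} {a c : ℂ} (hc : c ≠ 1) {K : ℕ} (hK : 0 < c.re + K)
    (h : Conv (c.re + K) (A ++ [a])) (u : ℕ) :
    nestList (A ++ [a]) (emRem K c) u =
      emCoeff (K + 2) c * nestList (A ++ [a + (c - 1 + (K + 2 : ℕ))]) (fun _ => 1) u +
        nestList (A ++ [a]) (emRem (K + 1) c) u := by
  rw [nestList_congr (fun x hx => emRem_eq_succ hc hK hx) _ (Or.inl (by simp)),
    nestList_add (ρ := c.re + K) (((decay_cpow _).mono (by simp; linarith)).const_mul _)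
      ((decay_emRem (K + 1) hc (by push_cast; linarith)).mono (by push_cast; linarith)) h,
    nestList_const_mul, nestList_cpow]

/-! ### Construction of the continuation -/

/-- The forbidden values are integers, and every set of integers is closed in `ℂ`. -/
theorem isClosed_isBad (k : ℕ) : IsClosed {w : ℂ | IsBad k w} := by
  have : {w : ℂ | IsBad k w} = (fun z : ℤ => (z : ℂ)) '' {z : ℤ | IsBad k (z : ℂ)} := by
    ext w
    constructor
    · intro h
      obtain ⟨z, -, rfl⟩ := h.exists_int
      exact ⟨z, h, rfl⟩
    · rintro ⟨z, hz, rfl⟩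
      exact hz
  rw [this]
  exact Complex.isClosedEmbedding_intCast.isClosedMap _ (isClosed_discrete _)

theorem isOpen_compl_singularSet (r : ℕ) : IsOpen (singularSet r)ᶜ := by
  have : (singularSet r)ᶜ = ⋂ k ∈ Finset.Icc 1 r, {s : Fin r → ℂ | ¬IsBad k (tailSum s k)} := by
    ext s
    rw [Set.mem_compl_iff, mem_singularSet_iff, not_not, Regular, tailAll_ofFn]
    simp
  rw [this]
  refine isOpen_biInter_finset fun k _ => ?_
  have hcont : Continuous fun s : Fin r → ℂ => tailSum s k := by
    unfold tailSum
    refine continuous_finsetSum _ fun i _ => ?_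
    split_ifs
    · exact continuous_apply i
    · exact continuous_const
  exact ((isClosed_isBad k).preimage hcont).isOpen_compl

theorem IsMultipleZetaFunction.differentiableAt {r : ℕ} {f : (Fin r → ℂ) → ℂ}
    (hf : IsMultipleZetaFunction r f) {s : Fin r → ℂ} (hs : Regular (List.ofFn s)) :
    DifferentiableAt ℂ f s := by
  have hs' : s ∈ (singularSet r)ᶜ := by
    rw [Set.mem_compl_iff, mem_singularSet_iff, not_not]
    exact hs
  exact hf.1.differentiableAt ((isOpen_compl_singularSet r).mem_nhds hs')

theorem IsMultipleZetaFunction.eq_nestList {r : ℕ} {f : (Fin r → ℂ) → ℂ}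
    (hf : IsMultipleZetaFunction r f) {s : Fin r → ℂ} (hs : Conv 0 (List.ofFn s)) :
    f s = nestList (List.ofFn s) (fun _ => 1) 0 :=
  (hf.2 s ((mem_convergenceRegion_iff s).2 hs)).unique (hasSum_chainTerm hs 0)

/-- `(s₁, …, s_q, s_{q+1}) ↦ (s₁, …, s_q + s_{q+1} + w)`. -/
def mergeLast {p : ℕ} (s : Fin (p + 2) → ℂ) (w : ℂ) : Fin (p + 1) → ℂ := fun i =>
  s i.castSucc + if i = Fin.last p then s (Fin.last (p + 1)) + w else 0

theorem ofFn_eq_append_pair {p : ℕ} (s : Fin (p + 2) → ℂ) :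
    List.ofFn s = (List.ofFn fun i : Fin p => s i.castSucc.castSucc) ++
      [s (Fin.last p).castSucc, s (Fin.last (p + 1))] := by
  rw [List.ofFn_succ', List.ofFn_succ']
  simp

theorem ofFn_castSucc_eq_append {p : ℕ} (s : Fin (p + 2) → ℂ) :
    (List.ofFn fun i : Fin (p + 1) => s i.castSucc) =
      (List.ofFn fun i : Fin p => s i.castSucc.castSucc) ++ [s (Fin.last p).castSucc] := by
  rw [List.ofFn_succ']
  simp

theorem ofFn_mergeLast {p : ℕ} (s : Fin (p + 2) → ℂ) (w : ℂ) :
    List.ofFn (mergeLast s w) = (List.ofFn fun i : Fin p => s i.castSucc.castSucc) ++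
      [s (Fin.last p).castSucc + (s (Fin.last (p + 1)) + w)] := by
  rw [List.ofFn_succ']
  simp [mergeLast, Fin.castSucc_ne_last]

/-- A crude sufficient condition, but an open one in `s`: one order of expansion works in a whole
neighbourhood. -/
theorem conv_of_sum_norm_lt {ρ : ℝ} {r : ℕ} (s : Fin r → ℂ) (h : r + ∑ i, ‖s i‖ < ρ) :
    Conv ρ (List.ofFn s) := by
  induction r with
  | zero => simp [conv_nil]
  | succ r ih =>
    rw [Fin.sum_univ_succ] at h
    push_cast at h
    have h0 := norm_nonneg (s 0)
    rw [List.ofFn_succ, conv_cons]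
    refine ⟨?_, ih _ (by linarith)⟩
    have h1 := (abs_le.1 (Complex.abs_re_le_norm (s 0))).1
    have h2 := (abs_le.1 (Complex.abs_re_le_norm (∑ i : Fin r, s i.succ))).1
    have h3 := norm_sum_le Finset.univ fun i : Fin r => s i.succ
    rw [List.length_ofFn, List.sum_ofFn]
    linarith

/-- The order `K` of the expansion is sufficient for the convergence of the remainder. -/
def IsLargeOrder {p : ℕ} (s : Fin (p + 2) → ℂ) (K : ℕ) : Prop := p + 1 + ∑ i, ‖s i‖ < K

theorem IsLargeOrder.conv {p : ℕ} {s : Fin (p + 2) → ℂ} {K : ℕ} (h : IsLargeOrder s K) :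
    Conv ((s (Fin.last (p + 1))).re + K) (List.ofFn fun i : Fin (p + 1) => s i.castSucc) := by
  refine conv_of_sum_norm_lt _ ?_
  rw [IsLargeOrder, Fin.sum_univ_castSucc] at h
  have h1 := (abs_le.1 (Complex.abs_re_le_norm (s (Fin.last (p + 1))))).1
  push_cast
  linarith

theorem IsLargeOrder.pos {p : ℕ} {s : Fin (p + 2) → ℂ} {K : ℕ} (h : IsLargeOrder s K) :
    0 < (s (Fin.last (p + 1))).re + K := by
  rw [IsLargeOrder, Fin.sum_univ_castSucc] at h
  have h1 := (abs_le.1 (Complex.abs_re_le_norm (s (Fin.last (p + 1))))).1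
  have h2 : 0 ≤ ∑ i : Fin (p + 1), ‖s i.castSucc‖ := by positivity
  have h3 : (0 : ℝ) ≤ p := by positivity
  linarith

theorem IsLargeOrder.mono {p : ℕ} {s : Fin (p + 2) → ℂ} {K K' : ℕ} (h : IsLargeOrder s K)
    (hK : K ≤ K') : IsLargeOrder s K' :=
  lt_of_lt_of_le h (by exact_mod_cast hK)

theorem exists_isLargeOrder {p : ℕ} (s : Fin (p + 2) → ℂ) : ∃ K, IsLargeOrder s K :=
  exists_nat_gt _

theorem IsLargeOrder.eventually {p : ℕ} {s : Fin (p + 2) → ℂ} {K : ℕ} (h : IsLargeOrder s K) :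
    ∀ᶠ t in 𝓝 s, IsLargeOrder t K := by
  have hc : Continuous fun t : Fin (p + 2) → ℂ => (p : ℝ) + 1 + ∑ i, ‖t i‖ := by fun_prop
  exact hc.continuousAt.eventually_lt_const h

/-- The continuation in depth `p + 2` in terms of the function `f` in depth `p + 1`. -/
def extendFormula {p : ℕ} (f : (Fin (p + 1) → ℂ) → ℂ) (K : ℕ) (s : Fin (p + 2) → ℂ) : ℂ :=
  ∑ i ∈ Finset.range (K + 2), emCoeff i (s (Fin.last (p + 1))) * f (mergeLast s (i - 1)) +
    nestList (List.ofFn fun i : Fin (p + 1) => s i.castSucc) (emRem K (s (Fin.last (p + 1)))) 0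

/-- The continuation in depth `p + 2`, with a sufficiently large order of the expansion. -/
def extend {p : ℕ} (f : (Fin (p + 1) → ℂ) → ℂ) (s : Fin (p + 2) → ℂ) : ℂ :=
  extendFormula f (exists_isLargeOrder s).choose s

theorem Regular.mergeLast {p : ℕ} {s : Fin (p + 2) → ℂ} (hs : Regular (List.ofFn s)) {i : ℕ}
    (hi : ¬(Odd i ∧ 1 < i)) : Regular (List.ofFn (mergeLast s (i - 1))) := by
  rw [ofFn_eq_append_pair] at hs
  have := hs.merge_last hi
  rw [ofFn_mergeLast]
  convert this using 4
  ring

theorem Regular.ofFn_last_ne_one {p : ℕ} {s : Fin (p + 2) → ℂ} (hs : Regular (List.ofFn s)) :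
    s (Fin.last (p + 1)) ≠ 1 := by
  rw [List.ofFn_succ', List.concat_eq_append] at hs
  exact hs.last_ne_one

section Extend

variable {p : ℕ} {f : (Fin (p + 1) → ℂ) → ℂ} {s : Fin (p + 2) → ℂ}

/-- The additional term sits at an index inside the region of convergence, where `f` is its series,
so it cancels the change of the remainder. -/
theorem extendFormula_succ (hf : IsMultipleZetaFunction (p + 1) f) (hs : Regular (List.ofFn s))
    {K : ℕ} (hK : IsLargeOrder s K) : extendFormula f K s = extendFormula f (K + 1) s := by
  have h1 := hK.conv
  rw [ofFn_castSucc_eq_append] at h1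
  have h2 : Conv 0 (List.ofFn (mergeLast s (((K + 2 : ℕ) : ℂ) - 1))) := by
    rw [ofFn_mergeLast, conv_add_last]
    refine h1.mono ?_
    simp
    linarith
  rw [extendFormula, extendFormula, Finset.sum_range_succ _ (K + 2), hf.eq_nestList h2,
    ofFn_mergeLast, ofFn_castSucc_eq_append, nestList_emRem_succ hs.ofFn_last_ne_one hK.pos h1]
  ring_nf

theorem extendFormula_eq_of_le (hf : IsMultipleZetaFunction (p + 1) f)
    (hs : Regular (List.ofFn s)) {K K' : ℕ} (hK : IsLargeOrder s K)
    (h : K ≤ K') : extendFormula f K s = extendFormula f K' s := by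
  induction K', h using Nat.le_induction with
  | base => rfl
  | succ n hn ih => rw [ih, extendFormula_succ hf hs (hK.mono hn)]

theorem extend_eq (hf : IsMultipleZetaFunction (p + 1) f) (hs : Regular (List.ofFn s)) {K : ℕ}
    (hK : IsLargeOrder s K) : extend f s = extendFormula f K s := by
  rcases le_total (exists_isLargeOrder s).choose K with h | h
  · exact extendFormula_eq_of_le hf hs (exists_isLargeOrder s).choose_spec h
  · exact (extendFormula_eq_of_le hf hs hK h).symm

theorem extend_of_conv (hf : IsMultipleZetaFunction (p + 1) f) (hs : Conv 0 (List.ofFn s)) :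
    extend f s = nestList (List.ofFn s) (fun _ => 1) 0 := by
  rw [ofFn_eq_append_pair] at hs
  rw [extend, extendFormula, ofFn_eq_append_pair,
    nestList_append_pair hs (exists_isLargeOrder s).choose, ofFn_castSucc_eq_append]
  congr 1
  refine Finset.sum_congr rfl fun i _ => ?_
  have h1 : Conv 0 (List.ofFn (mergeLast s ((i : ℂ) - 1))) := by
    rw [ofFn_mergeLast, conv_add_last]
    refine (conv_append_pair hs).1.mono ?_
    simp
    have : (0 : ℝ) ≤ i := by positivity
    linarith
  rw [hf.eq_nestList h1, ofFn_mergeLast]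
  ring_nf

theorem differentiable_mergeLast (w : ℂ) :
    Differentiable ℂ fun s : Fin (p + 2) → ℂ => mergeLast s w := by
  rw [differentiable_pi]
  intro i
  unfold mergeLast
  split_ifs <;> fun_prop

/-- The finite sum is holomorphic by the regularity of the merged indices, and the remainder by the
uniform convergence of its iterated series. -/
theorem differentiableAt_extendFormula (hf : IsMultipleZetaFunction (p + 1) f)
    (hs : Regular (List.ofFn s)) {K : ℕ} (hK : IsLargeOrder s K) :
    DifferentiableAt ℂ (extendFormula f K) s := by
  have hlast : ∀ t : Fin (p + 2) → ℂ, DifferentiableAt ℂ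
      (fun t : Fin (p + 2) → ℂ => t (Fin.last (p + 1))) t := fun t => by fun_prop
  refine (DifferentiableAt.fun_sum fun i _ => ?_).add ?_
  -- For odd `i > 1` the merged index may be singular, but the coefficient vanishes identically.
  · by_cases hi : Odd i ∧ 1 < i
    · simp only [emCoeff_eq_zero_of_odd hi.1 hi.2, zero_mul]
      exact differentiableAt_const _
    · exact ((differentiableAt_emCoeff i hs.ofFn_last_ne_one).comp s (hlast s)).mul
        ((hf.differentiableAt (hs.mergeLast hi)).comp s (differentiable_mergeLast _ s))
  · have hT := tameAt_emRem K (Eventually.of_forall hlast) hs.ofFn_last_ne_one hK.pos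
    have := hT.differentiableAt_nestList
      (L := List.ofFn fun (i : Fin (p + 1)) (t : Fin (p + 2) → ℂ) => t i.castSucc)
      (fun a ha => by
        obtain ⟨i, rfl⟩ := List.mem_ofFn.1 ha
        exact Eventually.of_forall fun t => by fun_prop)
      (by
        rw [List.map_ofFn]
        exact hK.conv)
      (by simp) 0
    simp only [List.map_ofFn] at this
    exact this

/-- `extend` chooses `K` separately at each point. Since the value is independent of `K`, it agrees
near `s` with the formula for one fixed `K`. -/
theorem isMultipleZetaFunction_extend (hf : IsMultipleZetaFunction (p + 1) f) :
    IsMultipleZetaFunction (p + 2) (extend f) := by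
  constructor
  · intro s hs
    have hev := (isOpen_compl_singularSet (p + 2)).mem_nhds hs
    rw [Set.mem_compl_iff, mem_singularSet_iff, not_not] at hs
    obtain ⟨K, hK⟩ := exists_isLargeOrder s
    refine (DifferentiableAt.congr_of_eventuallyEq
      (differentiableAt_extendFormula hf hs hK) ?_).differentiableWithinAt
    filter_upwards [hev, hK.eventually] with t ht hKt
    rw [Set.mem_compl_iff, mem_singularSet_iff, not_not] at ht
    exact extend_eq hf ht hKt
  · intro s hs
    rw [mem_convergenceRegion_iff] at hs
    rw [extend_of_conv hf hs]
    exact hasSum_chainTerm hs 0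

theorem extend_of_last_eq_neg (hf : IsMultipleZetaFunction (p + 1) f)
    (hs : Regular (List.ofFn s)) {m : ℕ} (hm : s (Fin.last (p + 1)) = -(m : ℂ)) :
    extend f s = ∑ i ∈ Finset.range (m + 2), (absorbCoeff m i : ℂ) * f (mergeLast s (i - 1)) := by
  obtain ⟨K, hK⟩ := exists_isLargeOrder s
  -- An order that is also at least `m` makes the remainder vanish.
  have hK' := hK.mono (le_max_left K m)
  rw [extend_eq hf hs hK', extendFormula, hm, nestList_congr
    (fun x hx => emRem_neg_natCast (le_max_right K m) hx) _ (Or.inl (by simp)), nestList_zero,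
    add_zero]
  simp only [emCoeff_neg_natCast]
  refine (Finset.sum_subset (Finset.range_subset_range.2 (by omega)) fun i _ hi => ?_).symm
  rw [Finset.mem_range, not_lt] at hi
  rw [absorbCoeff_eq_zero_of_lt (by omega)]
  simp

end Extend

/-! ### Depths zero and one, and the recursion on the depth -/

theorem isMultipleZetaFunction_zero : IsMultipleZetaFunction 0 fun _ => 1 := by
  refine ⟨differentiableOn_const _, fun s hs => ?_⟩
  rw [mem_convergenceRegion_iff] at hs
  have := hasSum_chainTerm hs 0
  rw [List.ofFn_zero] at this
  exact this

theorem isMultipleZetaFunction_one :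
    IsMultipleZetaFunction 1 fun s => riemannZeta (s 0) := by
  constructor
  · intro s hs
    rw [Set.mem_compl_iff, mem_singularSet_iff, not_not, List.ofFn_succ] at hs
    have h1 : s 0 ≠ 1 := by
      have := Regular.last_ne_one (A := []) (c := s 0) (by simpa using hs)
      exact this
    have h2 : DifferentiableAt ℂ (fun s : Fin 1 → ℂ => s 0) s := by fun_prop
    exact ((differentiableAt_riemannZeta h1).comp s h2).differentiableWithinAt
  · intro s hs
    rw [mem_convergenceRegion_iff] at hs
    have h1 := hasSum_chainTerm hs 0
    have h2 : 1 < (s 0).re := by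
      rw [List.ofFn_succ, conv_cons] at hs
      simpa using hs.1
    have h3 : nestList (List.ofFn s) (fun _ => 1) 0 = riemannZeta (s 0) := by
      rw [zeta_eq_tsum_one_div_nat_add_one_cpow h2]
      simp only [List.ofFn_succ, List.ofFn_zero, nestList_singleton, nest, tailSeries, mul_one]
      refine tsum_congr fun n => ?_
      rw [Complex.cpow_neg, one_div]
      push_cast
      ring_nf
    rw [h3] at h1
    exact h1

/-- The Euler–Zagier multiple zeta functions. -/
def multipleZeta : (r : ℕ) → (Fin r → ℂ) → ℂ
  | 0 => fun _ => 1
  | 1 => fun s => riemannZeta (s 0)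
  | p + 2 => extend (multipleZeta (p + 1))

theorem isMultipleZetaFunction_multipleZeta : ∀ r, IsMultipleZetaFunction r (multipleZeta r)
  | 0 => isMultipleZetaFunction_zero
  | 1 => isMultipleZetaFunction_one
  | p + 2 => isMultipleZetaFunction_extend (isMultipleZetaFunction_multipleZeta (p + 1))

/-! ### Values at lists, and lists moving along a line -/

/-- The value of a family of functions at a list of complex numbers. -/
def listValue (F : (r : ℕ) → (Fin r → ℂ) → ℂ) (l : List ℂ) : ℂ := F l.length l.get

theorem family_congr (F : (r : ℕ) → (Fin r → ℂ) → ℂ) {r r' : ℕ} (h : r = r') {s : Fin r → ℂ}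
    {s' : Fin r' → ℂ} (hs : ∀ i, s i = s' (Fin.cast h i)) : F r s = F r' s' := by
  subst h
  congr 1
  exact funext hs

theorem listValue_ofFn (F : (r : ℕ) → (Fin r → ℂ) → ℂ) {r : ℕ} (s : Fin r → ℂ) :
    listValue F (List.ofFn s) = F r s :=
  family_congr F (List.length_ofFn ..) fun i => by simp; rfl

theorem valueAt_eq_listValue (F : (r : ℕ) → (Fin r → ℂ) → ℂ) (n : List ℤ) :
    valueAt F n = listValue F (n.map (Int.cast : ℤ → ℂ)) :=
  family_congr F (List.length_map ..).symm fun i => by simp [toPoint]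

theorem isRegularIndex_iff (n : List ℤ) :
    IsRegularIndex n ↔ Regular (n.map (Int.cast : ℤ → ℂ)) := by
  rw [IsRegularIndex, mem_singularSet_iff, not_not]
  have : List.ofFn (toPoint n) = n.map (Int.cast : ℤ → ℂ) := by
    conv_rhs => rw [← List.ofFn_get n, List.map_ofFn]
    rfl
  rw [this]

theorem listValue_eq_nestList {F : (r : ℕ) → (Fin r → ℂ) → ℂ}
    (hF : ∀ r, IsMultipleZetaFunction r (F r)) {l : List ℂ} (hl : Conv 0 l) :
    listValue F l = nestList l (fun _ => 1) 0 := by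
  have := (hF l.length).eq_nestList (s := l.get) (by rwa [List.ofFn_get])
  rwa [List.ofFn_get] at this

/-- The list of entries `c + n z` for the pairs `(c, n)` in `M`. -/
def moved (M : List (ℂ × ℕ)) (z : ℂ) : List ℂ := M.map fun p => p.1 + p.2 * z

theorem moved_cons (p : ℂ × ℕ) (M : List (ℂ × ℕ)) (z : ℂ) :
    moved (p :: M) z = (p.1 + p.2 * z) :: moved M z := rfl

theorem length_moved (M : List (ℂ × ℕ)) (z : ℂ) : (moved M z).length = M.length :=
  List.length_map _

theorem sum_moved (M : List (ℂ × ℕ)) (z : ℂ) :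
    (moved M z).sum = (M.map Prod.fst).sum + ((M.map Prod.snd).sum : ℕ) * z := by
  induction M with
  | nil => simp [moved]
  | cons p M ih =>
    rw [moved_cons, List.sum_cons, ih]
    simp only [List.map_cons, List.sum_cons, Nat.cast_add]
    ring

theorem sum_moved_cons (p : ℂ × ℕ) (M : List (ℂ × ℕ)) (z : ℂ) :
    p.1 + p.2 * z + (moved M z).sum = p.1 + (M.map Prod.fst).sum +
      ((p.2 + (M.map Prod.snd).sum : ℕ) : ℂ) * z := by
  rw [sum_moved]
  push_cast
  ring

/-- The sum of every nonempty tail of `moved M z` depends on `z`. -/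
def MovingTails : List (ℂ × ℕ) → Prop
  | [] => True
  | p :: M => 0 < p.2 + (M.map Prod.snd).sum ∧ MovingTails M

theorem isOpen_regular_moved (M : List (ℂ × ℕ)) : IsOpen {z | Regular (moved M z)} := by
  induction M with
  | nil => simp [moved, regular_nil]
  | cons p M ih =>
    simp only [moved_cons, regular_cons, length_moved, sum_moved_cons, Set.ofPred_and]
    refine IsOpen.inter ?_ ih
    exact ((isClosed_isBad (M.length + 1)).preimage
      (f := fun z : ℂ => p.1 + (M.map Prod.fst).sum +
        ((p.2 + (M.map Prod.snd).sum : ℕ) : ℂ) * z) (by fun_prop)).isOpen_compl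

theorem countable_isBad (k : ℕ) : {w : ℂ | IsBad k w}.Countable := by
  refine (Set.countable_range fun z : ℤ => (z : ℂ)).mono fun w hw => ?_
  obtain ⟨z, -, rfl⟩ := IsBad.exists_int hw
  exact ⟨z, rfl⟩

/-- Each tail sum is a nonconstant affine function of `z`, so it meets the countable forbidden set
for countably many `z` only. -/
theorem MovingTails.countable {M : List (ℂ × ℕ)} (h : MovingTails M) :
    {z | Regular (moved M z)}ᶜ.Countable := by
  induction M with
  | nil => simp [moved, regular_nil]
  | cons p M ih =>
    simp only [moved_cons, regular_cons, length_moved, sum_moved_cons, Set.ofPred_and,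
      Set.compl_inter]
    refine Set.Countable.union ?_ (ih h.2)
    have hn : ((p.2 + (M.map Prod.snd).sum : ℕ) : ℂ) ≠ 0 := by exact_mod_cast h.1.ne'
    have hinj : Function.Injective fun z : ℂ => p.1 + (M.map Prod.fst).sum +
        ((p.2 + (M.map Prod.snd).sum : ℕ) : ℂ) * z := fun z w hzw =>
      mul_left_cancel₀ hn (add_left_cancel hzw)
    refine ((countable_isBad (M.length + 1)).preimage hinj).mono fun z hz => ?_
    simpa using hz

/-- Each tail sum has a coefficient of at least `1` at `z`, so its real part exceeds any bound as
`Re z → ∞`. -/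
theorem MovingTails.eventually_conv {M : List (ℂ × ℕ)} (h : MovingTails M) :
    ∀ᶠ z in comap Complex.re atTop, Conv 0 (moved M z) := by
  induction M with
  | nil => exact Eventually.of_forall fun _ => trivial
  | cons p M ih =>
    have hre : Tendsto Complex.re (comap Complex.re atTop) atTop := tendsto_comap
    have hn : (1 : ℝ) ≤ ((p.2 + (M.map Prod.snd).sum : ℕ) : ℝ) := by exact_mod_cast h.1
    filter_upwards [ih h.2, hre.eventually_gt_atTop
      (|(M.length : ℝ) + 1 - (p.1 + (M.map Prod.fst).sum).re|)] with z h1 h2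
    rw [moved_cons, conv_cons, length_moved]
    refine ⟨?_, h1⟩
    have h3 := congrArg Complex.re (sum_moved_cons p M z)
    rw [Complex.add_re, Complex.add_re (p.1 + _), ← Complex.ofReal_natCast (_ + _),
      Complex.re_ofReal_mul] at h3
    rw [h3]
    have h4 : z.re ≤ ((p.2 + (M.map Prod.snd).sum : ℕ) : ℝ) * z.re :=
      le_mul_of_one_le_left ((abs_nonneg _).trans h2.le) hn
    have h5 := (le_abs_self _).trans_lt h2
    linarith

theorem differentiableAt_listValue_moved {F : (r : ℕ) → (Fin r → ℂ) → ℂ}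
    (hF : ∀ r, IsMultipleZetaFunction r (F r)) {M : List (ℂ × ℕ)} {z : ℂ}
    (hz : Regular (moved M z)) : DifferentiableAt ℂ (fun z => listValue F (moved M z)) z := by
  have h1 : (fun z => listValue F (moved M z)) =
      F M.length ∘ fun z i => (M.get i).1 + (M.get i).2 * z := by
    funext z
    exact family_congr F (length_moved M z) fun i =>
      List.getElem_map _
  have h2 : ∀ z, (List.ofFn fun i => (M.get i).1 + (M.get i).2 * z) = moved M z := fun z => by
    conv_rhs => rw [← List.ofFn_get M, moved, List.map_ofFn]
    rfl
  rw [h1]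
  refine DifferentiableAt.comp z ((hF _).differentiableAt (by rwa [h2])) ?_
  rw [differentiableAt_pi]
  intro i
  fun_prop

/-- Identity theorem on the complement of a countable closed set. -/
theorem eqOn_of_eventually_re {D : Set ℂ} (hD : IsOpen D) (hc : Dᶜ.Countable) {f g : ℂ → ℂ}
    (hf : DifferentiableOn ℂ f D) (hg : DifferentiableOn ℂ g D)
    (h : ∀ᶠ z in comap Complex.re atTop, f z = g z) : Set.EqOn f g D := by
  have hconn : IsPreconnected D := by
    -- The complement of a countable set in a real vector space of dimension greater than one is
    -- connected.
    have := hc.isConnected_compl_of_one_lt_rank (by rw [Complex.rank_real_complex]; norm_num)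
    rw [compl_compl] at this
    exact this.isPreconnected
  rw [eventually_comap, eventually_atTop] at h
  obtain ⟨R, hR⟩ := h
  have hopen : IsOpen {z : ℂ | R < z.re} := isOpen_lt continuous_const Complex.continuous_re
  have hdense : Dense D := by
    have := hc.dense_compl ℝ
    rwa [compl_compl] at this
  obtain ⟨z₀, hz₀, hz₀D⟩ := hdense.inter_open_nonempty _ hopen ⟨((R + 1 : ℝ) : ℂ), by simp⟩
  refine (hf.analyticOnNhd hD).eqOn_of_preconnected_of_eventuallyEq (hg.analyticOnNhd hD) hconn
    hz₀D ?_
  filter_upwards [hopen.mem_nhds hz₀] with z hz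
  exact hR z.re (le_of_lt hz) z rfl

/-- The multiple zeta function is unique off the singularities. -/
theorem IsMultipleZetaFunction.eq_of_regular {r : ℕ} {f g : (Fin r → ℂ) → ℂ}
    (hf : IsMultipleZetaFunction r f) (hg : IsMultipleZetaFunction r g) {s : Fin r → ℂ}
    (hs : Regular (List.ofFn s)) : f s = g s := by
  -- The line `s + z (1, …, 1)` moves all tails and reaches the region of convergence for large `Re
  -- z`.
  set M : List (ℂ × ℕ) := List.ofFn fun i => (s i, 1) with hM
  have hmoved : ∀ z, moved M z = List.ofFn fun i => s i + z := fun z => by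
    rw [moved, hM, List.map_ofFn]
    congr 1
    funext i
    simp
  have hMT : ∀ {r : ℕ} (s : Fin r → ℂ), MovingTails (List.ofFn fun i => (s i, 1)) := by
    intro r
    induction r with
    | zero => intro s; simp [MovingTails]
    | succ r ih =>
      intro s
      rw [List.ofFn_succ]
      exact ⟨by simp, ih fun i => s i.succ⟩
  have hM' : MovingTails M := hMT s
  have hdiff : ∀ {h : (Fin r → ℂ) → ℂ}, IsMultipleZetaFunction r h →
      DifferentiableOn ℂ (fun z : ℂ => h fun i => s i + z) {z | Regular (moved M z)} := by
    intro h hh z hz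
    rw [Set.mem_ofPred_eq, hmoved] at hz
    have h2 : DifferentiableAt ℂ (fun (z : ℂ) (i : Fin r) => s i + z) z := by fun_prop
    exact ((hh.differentiableAt hz).comp z h2).differentiableWithinAt
  have key := eqOn_of_eventually_re (isOpen_regular_moved M) hM'.countable (hdiff hf) (hdiff hg)
    (by
      filter_upwards [hM'.eventually_conv] with z hz
      rw [hmoved] at hz
      rw [hf.eq_nestList hz, hg.eq_nestList hz])
  have h0 := key (x := 0) (by simpa [hmoved] using hs)
  simpa using h0

/-! ### Summation over a variable with a non-positive integral exponent -/

/-- The polynomial `ζ(-m) - ∑_{k=1}^{x} k ^ m`. -/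
def faulhaber (m x : ℕ) : ℂ :=
  ∑ i ∈ Finset.range (m + 2), (absorbCoeff m i : ℂ) * (x : ℂ) ^ (m + 1 - i)

theorem faulhaber_eq (m x : ℕ) :
    faulhaber m x = zetaNeg m - ∑ k ∈ Finset.Ico 1 (x + 1), (k : ℂ) ^ m := by
  have h := congrArg (fun q : ℚ => (q : ℂ)) (sum_absorbCoeff m x)
  push_cast at h
  exact h

theorem faulhaber_zero (m : ℕ) : faulhaber m 0 = zetaNeg m := by simp [faulhaber_eq]

theorem faulhaber_succ (m x : ℕ) :
    faulhaber m x = faulhaber m (x + 1) + ((x + 1 : ℕ) : ℂ) ^ m := by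
  rw [faulhaber_eq, faulhaber_eq, Finset.sum_Ico_succ_top (by omega : 1 ≤ x + 1)]
  ring

theorem Decay.faulhaber_mul {φ : ℕ → ℂ} {ρ : ℝ} (h : Decay φ ρ) (m : ℕ) :
    Decay (fun x => faulhaber m x * φ x) (ρ - (m + 1)) := by
  simp only [faulhaber, Finset.sum_mul, mul_assoc]
  refine Decay.sum _ fun i _ => ((h.pow_mul _).mono ?_).const_mul _
  have : ((m + 1 - i : ℕ) : ℝ) ≤ ((m + 1 : ℕ) : ℝ) := Nat.cast_le.2 (by omega)
  push_cast at this
  linarith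

theorem nest_sub_succ {b : ℂ} {φ : ℕ → ℂ} {ρ : ℝ} (h : Decay φ ρ) (hb : 1 < b.re + ρ) (v : ℕ) :
    nest b φ v = ((v + 1 : ℕ) : ℂ) ^ (-b) * φ (v + 1) + nest b φ (v + 1) := by
  have hs := (h.summable_nest hb v).of_norm
  rw [nest, tailSeries, hs.tsum_eq_zero_add, nest, tailSeries]
  congr 1
  refine tsum_congr fun n => ?_
  rw [show v + 1 + (n + 1) = v + 1 + 1 + n by omega]

theorem cast_sub_sub {b : ℂ} {m i : ℕ} (hi : i ∈ Finset.range (m + 2)) :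
    b - ((m + 1 - i : ℕ) : ℂ) = b - (m + 1) + i := by
  rw [Finset.mem_range] at hi
  rw [Nat.cast_sub (by omega)]
  push_cast
  ring

/-- Abel summation of `∑_{v > x} v ^ m ∑_{w > v} w ^ (-b) φ(w)`. -/
theorem nest_neg_nest {b : ℂ} {φ : ℕ → ℂ} {ρ : ℝ} (h : Decay φ ρ) (m : ℕ)
    (hb : m + 2 < b.re + ρ) (x : ℕ) :
    nest (-(m : ℂ)) (nest b φ) x = faulhaber m x * nest b φ x
      - ∑ i ∈ Finset.range (m + 2), (absorbCoeff m i : ℂ) * nest (b - (m + 1) + i) φ x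
      - nest (b - m) φ x := by
  have hm : (0 : ℝ) ≤ m := by positivity
  set Ψ := nest b φ with hΨ
  have hΨd : Decay Ψ (b.re + ρ - 1) := h.nest (by linarith)
  have h1 : Decay (fun y => (y : ℂ) ^ m * Ψ y) (b.re + ρ - 1 - m) := hΨd.pow_mul m
  have hψ : Decay (fun y => (y : ℂ) ^ (-b) * φ y) (b.re + ρ) := h.cpow_mul b
  have h2 : Decay (fun y => faulhaber m y * ((y : ℂ) ^ (-b) * φ y)) (b.re + ρ - (m + 1)) :=
    hψ.faulhaber_mul m
  have h3 : Decay (fun y => (y : ℂ) ^ m * ((y : ℂ) ^ (-b) * φ y)) (b.re + ρ - m) := hψ.pow_mul m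
  have hx : 1 ≤ x + 1 := by omega
  have s1 := (h1.summable_tail (by linarith) hx).of_norm
  have s2 := (h2.summable_tail (by linarith) hx).of_norm
  have s3 := (h3.summable_tail (by linarith) hx).of_norm
  -- The Faulhaber polynomial is a discrete antiderivative of the power: `faulhaber m v - faulhaber
  -- m (v + 1) = (v + 1) ^ m`. Hence `D` telescopes to the boundary term `faulhaber m x * nest b φ
  -- x`.
  set D : ℕ → ℂ := fun v => faulhaber m v * Ψ v with hD
  have hstep : ∀ v, D v - D (v + 1) = ((v + 1 : ℕ) : ℂ) ^ m * Ψ (v + 1) +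
      (faulhaber m (v + 1) * (((v + 1 : ℕ) : ℂ) ^ (-b) * φ (v + 1)) +
        ((v + 1 : ℕ) : ℂ) ^ m * (((v + 1 : ℕ) : ℂ) ^ (-b) * φ (v + 1))) := by
    intro v
    simp only [hD]
    rw [faulhaber_succ m v, hΨ, nest_sub_succ h (by linarith) v]
    ring
  have hsum : (fun n => D (x + n) - D (x + n + 1)) = fun n =>
      ((x + 1 + n : ℕ) : ℂ) ^ m * Ψ (x + 1 + n) +
      (faulhaber m (x + 1 + n) * (((x + 1 + n : ℕ) : ℂ) ^ (-b) * φ (x + 1 + n)) +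
        ((x + 1 + n : ℕ) : ℂ) ^ m * (((x + 1 + n : ℕ) : ℂ) ^ (-b) * φ (x + 1 + n))) := by
    funext n
    rw [hstep, show x + n + 1 = x + 1 + n by omega]
  have hDs : Summable fun n => D (x + n) - D (x + n + 1) := by
    rw [hsum]
    exact s1.add (s2.add s3)
  have htel := tailSeries_sub_succ (D := D) hDs
    ((hΨd.faulhaber_mul m).tendsto_zero (by linarith))
  have e1 : tailSeries (fun v => D v - D (v + 1)) x =
      tailSeries (fun y => (y : ℂ) ^ m * Ψ y) (x + 1) +
      (tailSeries (fun y => faulhaber m y * ((y : ℂ) ^ (-b) * φ y)) (x + 1) +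
        tailSeries (fun y => (y : ℂ) ^ m * ((y : ℂ) ^ (-b) * φ y)) (x + 1)) := by
    rw [← tailSeries_add (φ := fun y => faulhaber m y * ((y : ℂ) ^ (-b) * φ y))
      (ψ := fun y => (y : ℂ) ^ m * ((y : ℂ) ^ (-b) * φ y)) s2 s3,
      ← tailSeries_add (φ := fun y => (y : ℂ) ^ m * Ψ y) (ψ := fun y =>
        faulhaber m y * ((y : ℂ) ^ (-b) * φ y) + (y : ℂ) ^ m * ((y : ℂ) ^ (-b) * φ y))
        s1 (s2.add s3)]
    exact congrArg (fun f : ℕ → ℂ => ∑' n, f n) hsum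
  have e2 : tailSeries (fun y => (y : ℂ) ^ m * Ψ y) (x + 1) = nest (-(m : ℂ)) Ψ x := by
    simp [nest]
  have hj : ∀ j : ℕ, tailSeries (fun y => (y : ℂ) ^ j * ((y : ℂ) ^ (-b) * φ y)) (x + 1) =
      nest (b - j) φ x := fun j => by
    rw [← nest_pow_mul, nest]
    congr 1
    funext y
    ring
  have e4 : tailSeries (fun y => faulhaber m y * ((y : ℂ) ^ (-b) * φ y)) (x + 1) =
      ∑ i ∈ Finset.range (m + 2), (absorbCoeff m i : ℂ) * nest (b - (m + 1) + i) φ x := by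
    have hd : ∀ i ∈ Finset.range (m + 2), Decay (fun y => (y : ℂ) ^ (m + 1 - i) *
        ((y : ℂ) ^ (-b) * φ y)) (b.re + ρ - (m + 1)) := fun i hi => (hψ.pow_mul _).mono (by
      have : ((m + 1 - i : ℕ) : ℝ) ≤ ((m + 1 : ℕ) : ℝ) := Nat.cast_le.2 (by omega)
      push_cast at this
      linarith)
    -- With the single exponent `0`, an iterated sum is a plain tail sum, so linearity of `nestList`
    -- suffices.
    have := congrFun (nestList_sum (Finset.range (m + 2)) (fun i => (absorbCoeff m i : ℂ)) hd
      (l := [0]) (by rw [conv_cons]; exact ⟨by simp; linarith, trivial⟩)) x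
    simp only [nestList_singleton, nest, neg_zero, Complex.cpow_zero, one_mul] at this
    simp only [hj] at this
    simp only [faulhaber, Finset.sum_mul, mul_assoc]
    rw [this]
    exact Finset.sum_congr rfl fun i hi => by rw [cast_sub_sub hi]
  rw [htel, e2, e4, hj] at e1
  linear_combination -e1

/-! ### Recurrence relations for iterated sums -/

theorem nestList_neg_cons {b : ℂ} {B : List ℂ} {m : ℕ} (h : Conv 0 ((b - (m + 1)) :: B)) (u : ℕ) :
    nestList (-(m : ℂ) :: b :: B) (fun _ => 1) u =
      faulhaber m u * nestList (b :: B) (fun _ => 1) u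
      - ∑ i ∈ Finset.range (m + 2),
          (absorbCoeff m i : ℂ) * nestList ((b - (m + 1) + i) :: B) (fun _ => 1) u
      - nestList ((b - m) :: B) (fun _ => 1) u := by
  rw [conv_cons] at h
  refine nest_neg_nest (decay_nestList_one h.2) m ?_ u
  have := h.1
  simp at this
  linarith

theorem nestList_pow_mul (A : List ℂ) (a : ℂ) (j : ℕ) (φ : ℕ → ℂ) :
    nestList (A ++ [a]) (fun x => (x : ℂ) ^ j * φ x) = nestList (A ++ [a - j]) φ := by
  rw [nestList_append, nestList_append, nestList_singleton, nestList_singleton, nest_pow_mul]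

/-- The boundary term of the Abel summation is a polynomial in the preceding variable, so its powers
lower the exponent `a`. The convergence hypothesis concerns `b - (m + 1)`, the smallest exponent
that replaces `b`, and covers all other terms. -/
theorem nestList_append_neg_cons {A B : List ℂ} {a b : ℂ} {m : ℕ}
    (h : Conv 0 (A ++ a :: (b - (m + 1)) :: B)) (u : ℕ) :
    nestList (A ++ a :: -(m : ℂ) :: b :: B) (fun _ => 1) u =
      ∑ i ∈ Finset.range (m + 2),
          (absorbCoeff m i : ℂ) * nestList (A ++ (a - (m + 1) + i) :: b :: B) (fun _ => 1) u
      - ∑ i ∈ Finset.range (m + 2),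
          (absorbCoeff m i : ℂ) * nestList (A ++ a :: (b - (m + 1) + i) :: B) (fun _ => 1) u
      - nestList (A ++ a :: (b - m) :: B) (fun _ => 1) u := by
  have split : ∀ (x : ℂ) (t : List ℂ), A ++ x :: t = (A ++ [x]) ++ t := fun x t => by simp
  rw [split, conv_append] at h
  obtain ⟨h1, h2⟩ := h
  have h3 := conv_cons.1 h2
  set φ := nestList B fun _ => 1 with hφ
  have hφd : Decay φ (B.sum.re - B.length) := decay_nestList_one h3.2
  have hm : (0 : ℝ) ≤ m := by positivity
  have hb := h3.1
  simp only [List.sum_cons, List.length_cons, Complex.add_re, Complex.sub_re, Complex.natCast_re,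
    Complex.one_re, Nat.cast_add, Nat.cast_one] at h1 hb
  -- A common order of decay for all summands, dictated by the worst index `i = 0`.
  set ρ := 0 + (b.re - (m + 1) + B.sum.re) - ((B.length : ℝ) + 1) with hρ
  have hj : ∀ j : ℕ, j ≤ m + 1 → (j : ℝ) ≤ m + 1 := fun j hj => by
    exact_mod_cast (Nat.cast_le (α := ℝ)).2 hj
  have d1 : ∀ i ∈ Finset.range (m + 2), Decay (fun x : ℕ => (x : ℂ) ^ (m + 1 - i) * nest b φ x) ρ :=
    fun i _ => ((hφd.nest (by linarith)).pow_mul _).mono (by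
      have := hj (m + 1 - i) (by omega)
      linarith)
  have d2 : ∀ i ∈ Finset.range (m + 2), Decay (nest (b - (m + 1) + i) φ) ρ := fun i _ => by
    have hi : (0 : ℝ) ≤ i := by positivity
    refine (hφd.nest ?_).mono ?_
    · simp
      linarith
    · simp
      linarith
  have d3 : Decay (nest (b - m) φ) ρ := by
    refine (hφd.nest ?_).mono ?_
    · simp
      linarith
    · simp
      linarith
  have e : nestList (-(m : ℂ) :: b :: B) (fun _ => 1) = fun x : ℕ =>
      ∑ i ∈ Finset.range (m + 2), (absorbCoeff m i : ℂ) * ((x : ℂ) ^ (m + 1 - i) * nest b φ x) +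
      (-1) * (∑ i ∈ Finset.range (m + 2), (absorbCoeff m i : ℂ) * nest (b - (m + 1) + i) φ x +
        nest (b - m) φ x) := by
    funext x
    rw [nestList_neg_cons h2, faulhaber, Finset.sum_mul]
    simp only [mul_assoc, nestList_cons, ← hφ]
    ring
  have s1 : Decay (fun x => ∑ i ∈ Finset.range (m + 2),
      (absorbCoeff m i : ℂ) * ((x : ℂ) ^ (m + 1 - i) * nest b φ x)) ρ :=
    Decay.sum _ fun i hi => (d1 i hi).const_mul _
  have s2 : Decay (fun x => ∑ i ∈ Finset.range (m + 2),
      (absorbCoeff m i : ℂ) * nest (b - (m + 1) + i) φ x) ρ :=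
    Decay.sum _ fun i hi => (d2 i hi).const_mul _
  rw [split, nestList_append, e, nestList_add s1 ((s2.add d3).const_mul _) h1,
    nestList_const_mul, nestList_add s2 d3 h1, nestList_sum _ _ d1 h1, nestList_sum _ _ d2 h1]
  have e1 : ∀ i ∈ Finset.range (m + 2),
      nestList (A ++ [a]) (fun x : ℕ => (x : ℂ) ^ (m + 1 - i) * nest b φ x) u =
        nestList (A ++ (a - (m + 1) + i) :: b :: B) (fun _ => 1) u := fun i hi => by
    rw [nestList_pow_mul, cast_sub_sub hi, split _ (b :: B), nestList_append _ (b :: B)]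
    rfl
  have e2 : ∀ c : ℂ, nestList (A ++ [a]) (nest c φ) u =
      nestList (A ++ a :: c :: B) (fun _ => 1) u := fun c => by
    rw [split a (c :: B), nestList_append _ (c :: B)]
    rfl
  simp only [e2]
  rw [Finset.sum_congr rfl fun i hi => by rw [e1 i hi]]
  ring

/-! ### Recurrence relations for the continued functions -/

theorem exists_ofFn_eq {l : List ℂ} {r : ℕ} (h : l.length = r) :
    ∃ s : Fin r → ℂ, List.ofFn s = l := by
  subst h
  exact ⟨l.get, List.ofFn_get l⟩

theorem not_odd_of_absorbCoeff_ne_zero {m i : ℕ} (h : absorbCoeff m i ≠ 0) :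
    ¬(Odd i ∧ 1 < i) := fun hi => h (absorbCoeff_eq_zero_of_odd hi.1 hi.2)

theorem Regular.absorb_last {A : List ℂ} {a : ℂ} {m i : ℕ} (h : Regular (A ++ [a, -(m : ℂ)]))
    (hi : ¬(Odd i ∧ 1 < i)) : Regular (A ++ [a - (m + 1) + i]) := by
  have := h.merge_last hi
  rwa [show a + (-(m : ℂ) - 1 + i) = a - (m + 1) + i by ring] at this

/-- No parity condition is needed: the original tail starting at `a` has length at least three, so
all integers up to its length are already excluded. -/
theorem Regular.absorb_left {A B : List ℂ} {a b : ℂ} {m : ℕ}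
    (h : Regular (A ++ a :: -(m : ℂ) :: b :: B)) (i : ℕ) :
    Regular (A ++ (a - (m + 1) + i) :: b :: B) := by
  have ht := h.of_append
  refine h.replace_tail (d := i - 1) ⟨fun hb => ?_, ht.2.2⟩ (by simp) (by simp) (by omega) ?_
  · refine ht.1 ?_
    have e : a - (m + 1) + (i : ℂ) + (b :: B).sum = a + (-(m : ℂ) :: b :: B).sum +
        ((i - 1 : ℤ) : ℂ) := by
      simp only [List.sum_cons]
      push_cast
      ring
    rw [e] at hb
    exact IsBad.succ_of_add (by simp) (by omega) hb
  · simp only [List.sum_cons]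
    push_cast
    ring

/-- Parity matters only if `B` is empty. Then a tail of length two is replaced by one of length one.
-/
theorem Regular.absorb_right {A B : List ℂ} {b : ℂ} {m i : ℕ}
    (h : Regular (A ++ -(m : ℂ) :: b :: B)) (hi : ¬(Odd i ∧ 1 < i)) :
    Regular (A ++ (b - (m + 1) + i) :: B) := by
  have ht := h.of_append
  refine h.replace_tail (d := i - 1) ⟨fun hb => ?_, ht.2.2⟩ (by simp) (by simp) (by omega) ?_
  · refine ht.1 ?_
    cases B with
    | nil =>
      have e : b - (m + 1) + (i : ℂ) + ([] : List ℂ).sum = -(m : ℂ) + [b].sum + (i - 1) := by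
        simp only [List.sum_cons, List.sum_nil]
        ring
      rw [e] at hb
      exact IsBad.two_of_add hi hb
    | cons c B =>
      have e : b - (m + 1) + (i : ℂ) + (c :: B).sum = -(m : ℂ) + (b :: c :: B).sum +
          ((i - 1 : ℤ) : ℂ) := by
        simp only [List.sum_cons]
        push_cast
        ring
      rw [e] at hb
      exact IsBad.succ_of_add (by simp) (by omega) hb
  · simp only [List.sum_cons]
    push_cast
    ring

theorem Regular.absorb_single {A B : List ℂ} {b : ℂ} {m : ℕ}
    (h : Regular (A ++ -(m : ℂ) :: b :: B)) : Regular (A ++ (b - m) :: B) := by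
  have := h.absorb_right (i := 1) (by simp)
  rwa [show b - (m + 1) + ((1 : ℕ) : ℂ) = b - m by push_cast; ring] at this

section Recurrence

variable {F : (r : ℕ) → (Fin r → ℂ) → ℂ}

/-- A last entry `-m` is incompatible with convergence, so the line argument is unavailable.
Instead, uniqueness identifies `F` with the explicit continuation, whose expansion stops at `-m`. -/
theorem listValue_last (hF : ∀ r, IsMultipleZetaFunction r (F r)) {A : List ℂ} {a : ℂ} {m : ℕ}
    (h : Regular (A ++ [a, -(m : ℂ)])) : listValue F (A ++ [a, -(m : ℂ)]) =
      ∑ i ∈ Finset.range (m + 2),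
        (absorbCoeff m i : ℂ) * listValue F (A ++ [a - (m + 1) + i]) := by
  obtain ⟨s, hs⟩ := exists_ofFn_eq (l := A ++ [a, -(m : ℂ)]) (r := A.length + 2) (by simp)
  have hs' := hs
  rw [ofFn_eq_append_pair] at hs'
  obtain ⟨h1, h2⟩ := List.append_inj hs' (by simp)
  simp only [List.cons.injEq, and_true] at h2
  rw [← hs] at h ⊢
  rw [listValue_ofFn, (hF _).eq_of_regular (isMultipleZetaFunction_extend (hF _)) h,
    extend_of_last_eq_neg (hF _) h h2.2]
  refine Finset.sum_congr rfl fun i _ => ?_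
  rw [← listValue_ofFn F, ofFn_mergeLast, h1, h2.1, h2.2]
  ring_nf

theorem listValue_nil (hF : ∀ r, IsMultipleZetaFunction r (F r)) : listValue F [] = 1 :=
  listValue_eq_nestList hF (conv_nil 0)

theorem listValue_single (hF : ∀ r, IsMultipleZetaFunction r (F r)) {m : ℕ}
    (h : Regular [-(m : ℂ)]) : listValue F [-(m : ℂ)] = zetaNeg m := by
  have e : [-(m : ℂ)] = List.ofFn fun _ : Fin 1 => -(m : ℂ) := by simp
  rw [e] at h ⊢
  rw [listValue_ofFn, (hF 1).eq_of_regular isMultipleZetaFunction_one h,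
    riemannZeta_neg_eq_zetaNeg]

/-- A term with coefficient `0` is harmless even at a singular index. This accommodates the omitted
terms of the recurrence. -/
theorem differentiableOn_const_mul_listValue (hF : ∀ r, IsMultipleZetaFunction r (F r))
    {M : List (ℂ × ℕ)} {c : ℂ} {D : Set ℂ} (h : c ≠ 0 → ∀ z ∈ D, Regular (moved M z)) :
    DifferentiableOn ℂ (fun z => c * listValue F (moved M z)) D := by
  by_cases hc : c = 0
  · simp only [hc, zero_mul]
    exact differentiableOn_const _
  · exact fun z hz =>
      ((differentiableAt_listValue_moved hF (h hc z hz)).const_mul c).differentiableWithinAt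

/-- The list with all entries moving with unit speed. -/
def unitSpeed (A : List ℂ) : List (ℂ × ℕ) := A.map fun c => (c, 1)

theorem moved_unitSpeed_zero (A : List ℂ) : moved (unitSpeed A) 0 = A := by
  simp [moved, unitSpeed, Function.comp_def]

theorem MovingTails.unitSpeed_append {M : List (ℂ × ℕ)} (h : MovingTails M) (A : List ℂ) :
    MovingTails (unitSpeed A ++ M) := by
  induction A with
  | nil => exact h
  | cons a A ih => exact ⟨by simp, ih⟩

theorem movingTails_unitSpeed (A : List ℂ) : MovingTails (unitSpeed A) := by
  simpa using MovingTails.unitSpeed_append (M := []) trivial A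

/-- For large `Re z` this is the Abel summation at `u = 0`, where the Faulhaber polynomial has the
value `ζ(-m)`. The identity theorem carries it to `z = 0`. -/
theorem listValue_first (hF : ∀ r, IsMultipleZetaFunction r (F r)) {b : ℂ} {B : List ℂ} {m : ℕ}
    (h : Regular (-(m : ℂ) :: b :: B)) : listValue F (-(m : ℂ) :: b :: B) =
      zetaNeg m * listValue F (b :: B)
      - ∑ i ∈ Finset.range (m + 2),
          (absorbCoeff m i : ℂ) * listValue F ((b - (m + 1) + i) :: B)
      - listValue F ((b - m) :: B) := by
  -- The entry `-m` stands still. As `b` follows it and moves, every tail sum still depends on `z`.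
  set M : List (ℂ × ℕ) := (-(m : ℂ), 0) :: (b, 1) :: unitSpeed B with hM
  set N : ℂ → List (ℂ × ℕ) := fun c => (c, 1) :: unitSpeed B with hN
  have hMz : ∀ z, moved M z = -(m : ℂ) :: (b + z) :: moved (unitSpeed B) z := fun z => by
    simp [hM, moved]
  have hNz : ∀ c z, moved (N c) z = (c + z) :: moved (unitSpeed B) z := fun c z => by
    simp [hN, moved]
  have hMm : MovingTails M := ⟨by simp, by simp, movingTails_unitSpeed B⟩
  have hNm : ∀ c, MovingTails (N c) := fun c => ⟨by simp, movingTails_unitSpeed B⟩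
  have comm : ∀ (i : ℕ) (z : ℂ), b - (m + 1) + i + z = b + z - (m + 1) + i := fun i z => by ring
  have comm' : ∀ z : ℂ, b - m + z = b + z - m := fun z => by ring
  have hreg : ∀ z ∈ {z | Regular (moved M z)}, Regular ([] ++ -(m : ℂ) :: (b + z) ::
      moved (unitSpeed B) z) := fun z hz => by
    rw [← hMz]
    exact hz
  have hf : DifferentiableOn ℂ (fun z => listValue F (moved M z)) {z | Regular (moved M z)} :=
    fun z hz => (differentiableAt_listValue_moved hF hz).differentiableWithinAt
  have hg : DifferentiableOn ℂ (fun z => zetaNeg m * listValue F (moved (N b) z)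
      - ∑ i ∈ Finset.range (m + 2),
          (absorbCoeff m i : ℂ) * listValue F (moved (N (b - (m + 1) + i)) z)
      - 1 * listValue F (moved (N (b - m)) z)) {z | Regular (moved M z)} := by
    refine ((differentiableOn_const_mul_listValue hF fun _ z hz => ?_).sub
      (DifferentiableOn.fun_sum fun i _ =>
        differentiableOn_const_mul_listValue hF fun hc z hz => ?_)).sub
      (differentiableOn_const_mul_listValue hF fun _ z hz => ?_)
    · rw [hNz]
      exact (hreg z hz).2
    · rw [hNz, comm]
      exact (hreg z hz).absorb_right (not_odd_of_absorbCoeff_ne_zero (by exact_mod_cast hc))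
    · rw [hNz, comm']
      exact (hreg z hz).absorb_single
  have key := eqOn_of_eventually_re (isOpen_regular_moved M) hMm.countable hf hg (by
    filter_upwards [hMm.eventually_conv, (hNm b).eventually_conv, (hNm (b - m)).eventually_conv,
      (Filter.eventually_all_finset (Finset.range (m + 2))).2 fun i _ =>
        (hNm (b - (m + 1) + i)).eventually_conv] with z h1 h2 h3 h4
    rw [listValue_eq_nestList hF h1, listValue_eq_nestList hF h2, listValue_eq_nestList hF h3,
      Finset.sum_congr rfl fun i hi => by rw [listValue_eq_nestList hF (h4 i hi)]]
    -- The index with `i = 0` contains `b - (m + 1)`, and its convergence is the hypothesis of the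
    -- Abel summation.
    have h5 := h4 0 (by simp)
    simp only [hMz, hNz, comm, comm'] at h5 ⊢
    rw [Nat.cast_zero, add_zero] at h5
    rw [nestList_neg_cons h5, faulhaber_zero, one_mul])
  have h0 := key (x := 0) (by
    rw [Set.mem_ofPred_eq, hMz, moved_unitSpeed_zero, add_zero]
    exact h)
  simpa only [hMz, hNz, moved_unitSpeed_zero, add_zero, one_mul] using h0

/-- As for the first entry, the relation is proved for large `Re z` and continued along the line to
`z = 0`. -/
theorem listValue_middle (hF : ∀ r, IsMultipleZetaFunction r (F r)) {A B : List ℂ} {a b : ℂ}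
    {m : ℕ} (h : Regular (A ++ a :: -(m : ℂ) :: b :: B)) :
    listValue F (A ++ a :: -(m : ℂ) :: b :: B) =
      ∑ i ∈ Finset.range (m + 2),
          (absorbCoeff m i : ℂ) * listValue F (A ++ (a - (m + 1) + i) :: b :: B)
      - ∑ i ∈ Finset.range (m + 2),
          (absorbCoeff m i : ℂ) * listValue F (A ++ a :: (b - (m + 1) + i) :: B)
      - listValue F (A ++ a :: (b - m) :: B) := by
  set M : List (ℂ × ℕ) :=
    unitSpeed A ++ (a, 1) :: (-(m : ℂ), 0) :: (b, 1) :: unitSpeed B with hM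
  set N : ℂ → ℂ → List (ℂ × ℕ) := fun c d =>
    unitSpeed A ++ (c, 1) :: (d, 1) :: unitSpeed B with hN
  have hMz : ∀ z, moved M z = moved (unitSpeed A) z ++ (a + z) :: -(m : ℂ) :: (b + z) ::
      moved (unitSpeed B) z := fun z => by simp [hM, moved]
  have hNz : ∀ c d z, moved (N c d) z = moved (unitSpeed A) z ++ (c + z) :: (d + z) ::
      moved (unitSpeed B) z := fun c d z => by simp [hN, moved]
  have hMm : MovingTails M :=
    MovingTails.unitSpeed_append (M := (a, 1) :: (-(m : ℂ), 0) :: (b, 1) :: unitSpeed B)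
      ⟨by simp, by simp, by simp, movingTails_unitSpeed B⟩ A
  have hNm : ∀ c d, MovingTails (N c d) := fun c d =>
    MovingTails.unitSpeed_append (M := (c, 1) :: (d, 1) :: unitSpeed B)
      ⟨by simp, by simp, movingTails_unitSpeed B⟩ A
  have comm : ∀ (c : ℂ) (i : ℕ) (z : ℂ), c - (m + 1) + i + z = c + z - (m + 1) + i :=
    fun c i z => by ring
  have comm' : ∀ z : ℂ, b - m + z = b + z - m := fun z => by ring
  have assoc : ∀ (X : List ℂ) (x : ℂ) (t : List ℂ), X ++ x :: t = (X ++ [x]) ++ t :=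
    fun X x t => by simp
  have hreg : ∀ z ∈ {z | Regular (moved M z)}, Regular (moved (unitSpeed A) z ++ (a + z) ::
      -(m : ℂ) :: (b + z) :: moved (unitSpeed B) z) := fun z hz => by
    rw [← hMz]
    exact hz
  have hf : DifferentiableOn ℂ (fun z => listValue F (moved M z)) {z | Regular (moved M z)} :=
    fun z hz => (differentiableAt_listValue_moved hF hz).differentiableWithinAt
  have hg : DifferentiableOn ℂ (fun z => ∑ i ∈ Finset.range (m + 2),
          (absorbCoeff m i : ℂ) * listValue F (moved (N (a - (m + 1) + i) b) z)
      - ∑ i ∈ Finset.range (m + 2),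
          (absorbCoeff m i : ℂ) * listValue F (moved (N a (b - (m + 1) + i)) z)
      - 1 * listValue F (moved (N a (b - m)) z)) {z | Regular (moved M z)} := by
    refine ((DifferentiableOn.fun_sum fun i _ =>
        differentiableOn_const_mul_listValue hF fun _ z hz => ?_).sub
      (DifferentiableOn.fun_sum fun i _ =>
        differentiableOn_const_mul_listValue hF fun hc z hz => ?_)).sub
      (differentiableOn_const_mul_listValue hF fun _ z hz => ?_)
    · rw [hNz, comm]
      exact (hreg z hz).absorb_left i
    -- The entry `a` is counted with the left part, so that the tail to be replaced starts at `-m`.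
    · have := hreg z hz
      rw [assoc] at this
      rw [hNz, comm, assoc]
      exact this.absorb_right (not_odd_of_absorbCoeff_ne_zero (by exact_mod_cast hc))
    · have := hreg z hz
      rw [assoc] at this
      rw [hNz, comm', assoc]
      exact this.absorb_single
  have key := eqOn_of_eventually_re (isOpen_regular_moved M) hMm.countable hf hg (by
    filter_upwards [hMm.eventually_conv, (hNm a (b - m)).eventually_conv,
      (Filter.eventually_all_finset (Finset.range (m + 2))).2 fun i _ =>
        (hNm (a - (m + 1) + i) b).eventually_conv,
      (Filter.eventually_all_finset (Finset.range (m + 2))).2 fun i _ =>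
        (hNm a (b - (m + 1) + i)).eventually_conv] with z h1 h2 h3 h4
    have sum_eq : ∀ L : ℕ → List (ℂ × ℕ), (∀ i ∈ Finset.range (m + 2), Conv 0 (moved (L i) z)) →
        ∑ i ∈ Finset.range (m + 2), (absorbCoeff m i : ℂ) * listValue F (moved (L i) z) =
        ∑ i ∈ Finset.range (m + 2), (absorbCoeff m i : ℂ) *
          nestList (moved (L i) z) (fun _ => 1) 0 := fun L hL =>
      Finset.sum_congr rfl fun i hi => by rw [listValue_eq_nestList hF (hL i hi)]
    rw [listValue_eq_nestList hF h1, listValue_eq_nestList hF h2, sum_eq _ h3, sum_eq _ h4]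
    have h5 := h4 0 (by simp)
    simp only [hMz, hNz, comm, comm'] at h5 ⊢
    rw [Nat.cast_zero, add_zero] at h5
    rw [nestList_append_neg_cons h5, one_mul])
  have h0 := key (x := 0) (by
    rw [Set.mem_ofPred_eq, hMz, moved_unitSpeed_zero, moved_unitSpeed_zero, add_zero, add_zero]
    exact h)
  simpa only [hMz, hNz, moved_unitSpeed_zero, add_zero, one_mul] using h0

end Recurrence

/-! ### The recurrence relation for formal combinations -/

/-- Vanishing coefficients do not contribute to the support, so odd `i > 1` need not be checked. -/
theorem absorb_mem_supported {S : Set (List ℤ)} {ι : ℤ → List ℤ} {a : ℤ} {m : ℕ}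
    (h : ∀ i : ℕ, i ≤ m + 1 → ¬(Odd i ∧ 1 < i) → ι (a - (m + 1) + i) ∈ S) :
    absorb ι a m ∈ Finsupp.supported ℚ ℚ S := by
  rw [absorb_eq]
  refine Submodule.sum_mem _ fun i hi => ?_
  by_cases hc : absorbCoeff m i = 0
  · rw [hc, Finsupp.single_zero]
    exact Submodule.zero_mem _
  · rw [Finset.mem_range] at hi
    exact Finsupp.single_mem_supported ℚ _ (h i (by omega) (not_odd_of_absorbCoeff_ne_zero hc))

/-- The image of an integer index in the complex numbers. -/
abbrev castList (n : List ℤ) : List ℂ := n.map (Int.cast : ℤ → ℂ)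

theorem RecurrenceRHS.mem_supported_regular {n : List ℤ} {c : List ℤ →₀ ℚ}
    (h : RecurrenceRHS n c) (hn : IsRegularIndex n) :
    c ∈ Finsupp.supported ℚ ℚ {k | IsRegularIndex k} := by
  rw [isRegularIndex_iff] at hn
  simp only [isRegularIndex_iff]
  cases h with
  | single m => exact Finsupp.single_mem_supported ℚ _ regular_nil
  | first m b B =>
    simp only [List.map_cons, Int.cast_neg, Int.cast_natCast] at hn
    refine Submodule.sub_mem _ (Submodule.add_mem _ (Submodule.neg_mem _
      (absorb_mem_supported fun i _ hi => ?_)) (Finsupp.single_mem_supported ℚ _ ?_))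
      (Finsupp.single_mem_supported ℚ _ ?_)
    · simpa using Regular.absorb_right (A := []) hn hi
    · exact hn.2
    · simpa using Regular.absorb_single (A := []) hn
  | last A a m =>
    simp only [List.map_append, List.map_cons, List.map_nil, Int.cast_neg, Int.cast_natCast] at hn
    refine absorb_mem_supported fun i _ hi => ?_
    simpa using hn.absorb_last hi
  | middle A a m b B =>
    simp only [List.map_append, List.map_cons, Int.cast_neg, Int.cast_natCast] at hn
    have hn' : Regular ((A.map (Int.cast : ℤ → ℂ) ++ [(a : ℂ)]) ++
        -(m : ℂ) :: (b : ℂ) :: B.map (Int.cast : ℤ → ℂ)) := by simpa using hn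
    refine Submodule.sub_mem _ (Submodule.sub_mem _
      (absorb_mem_supported fun i _ _ => ?_) (absorb_mem_supported fun i _ hi => ?_))
      (Finsupp.single_mem_supported ℚ _ ?_)
    · simpa using hn.absorb_left i
    · simpa using hn'.absorb_right hi
    · simpa using hn'.absorb_single

section Value

variable {F : (r : ℕ) → (Fin r → ℂ) → ℂ}

theorem sum_mul_eq_linearCombination (v : List ℤ → ℂ) (c : List ℤ →₀ ℚ) :
    (c.sum fun k q => (q : ℂ) * v k) = Finsupp.linearCombination ℚ v c := by
  simp only [Finsupp.linearCombination_apply, Rat.smul_def]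

theorem linearCombination_absorb (v : List ℤ → ℂ) (ι : ℤ → List ℤ) (a : ℤ) (m : ℕ) :
    Finsupp.linearCombination ℚ v (absorb ι a m) =
      ∑ i ∈ Finset.range (m + 2), (absorbCoeff m i : ℂ) * v (ι (a - (m + 1) + i)) := by
  simp only [absorb_eq, map_sum, Finsupp.linearCombination_single, Rat.smul_def]

theorem RecurrenceRHS.valueAt_eq (hF : ∀ r, IsMultipleZetaFunction r (F r)) {n : List ℤ}
    {c : List ℤ →₀ ℚ} (h : RecurrenceRHS n c) (hn : IsRegularIndex n) :
    valueAt F n = Finsupp.linearCombination ℚ (valueAt F) c := by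
  rw [isRegularIndex_iff] at hn
  cases h with
  | single m =>
    simp only [List.map_cons, List.map_nil, Int.cast_neg, Int.cast_natCast] at hn
    simp only [Finsupp.linearCombination_single, Rat.smul_def, valueAt_eq_listValue, List.map_cons,
      List.map_nil, Int.cast_neg, Int.cast_natCast]
    rw [listValue_single hF hn, listValue_nil hF, mul_one]
  | first m b B =>
    simp only [List.map_cons, Int.cast_neg, Int.cast_natCast] at hn
    simp only [map_add, map_sub, map_neg, linearCombination_absorb,
      Finsupp.linearCombination_single, Rat.smul_def, valueAt_eq_listValue, List.map_cons, Int.cast_neg, Int.cast_natCast,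
      Int.cast_add, Int.cast_sub, Int.cast_one, Rat.cast_one]
    rw [listValue_first hF hn]
    ring
  | last A a m =>
    simp only [List.map_append, List.map_cons, List.map_nil, Int.cast_neg, Int.cast_natCast] at hn
    simp only [linearCombination_absorb, valueAt_eq_listValue, List.map_append, List.map_cons,
      List.map_nil, Int.cast_neg, Int.cast_natCast, Int.cast_add, Int.cast_sub, Int.cast_one]
    rw [listValue_last hF hn]
  | middle A a m b B =>
    simp only [List.map_append, List.map_cons, Int.cast_neg, Int.cast_natCast] at hn
    simp only [map_sub, linearCombination_absorb, Finsupp.linearCombination_single, Rat.smul_def,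
      valueAt_eq_listValue, List.map_append, List.map_cons, Int.cast_neg, Int.cast_natCast,
      Int.cast_add, Int.cast_sub, Int.cast_one, Rat.cast_one]
    rw [listValue_middle hF hn]
    ring

end Value

/-! ### Depth and weight -/

theorem posDepth_append (A B : List ℤ) : posDepth (A ++ B) = posDepth A + posDepth B := by
  simp [posDepth, positivePart]

theorem posWeight_append (A B : List ℤ) : posWeight (A ++ B) = posWeight A + posWeight B := by
  simp [posWeight, positivePart]

theorem posDepth_cons (a : ℤ) (B : List ℤ) :
    posDepth (a :: B) = (if 0 < a then 1 else 0) + posDepth B := by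
  by_cases h : 0 < a <;> simp [posDepth, positivePart, h, add_comm]

theorem posWeight_cons (a : ℤ) (B : List ℤ) :
    posWeight (a :: B) = (if 0 < a then a else 0) + posWeight B := by
  by_cases h : 0 < a <;> simp [posWeight, positivePart, h]

/-- The indices that are shorter than `n` and have at most the positive depth and weight of `n`. -/
def smallerIndices (n : List ℤ) : Set (List ℤ) :=
  {k | k.length < n.length ∧ posDepth k ≤ posDepth n ∧ posWeight k ≤ posWeight n}

/-- A changed entry is `a - (m + 1) + i` with `i ≤ m + 1`, or `b - m`, hence at most the old one.
The deleted entry is nonpositive and did not count. -/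
theorem RecurrenceRHS.mem_supported_smaller {n : List ℤ} {c : List ℤ →₀ ℚ}
    (h : RecurrenceRHS n c) : c ∈ Finsupp.supported ℚ ℚ (smallerIndices n) := by
  cases h with
  | single m =>
    refine Finsupp.single_mem_supported ℚ _ ⟨by simp, ?_, ?_⟩ <;>
    simp only [posDepth_cons, posWeight_cons] <;>
    split_ifs <;> simp [posDepth, posWeight, positivePart]; omega
  | first m b B =>
    refine Submodule.sub_mem _ (Submodule.add_mem _ (Submodule.neg_mem _
      (absorb_mem_supported fun i _ hi => ?_)) (Finsupp.single_mem_supported ℚ _ ?_))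
      (Finsupp.single_mem_supported ℚ _ ?_) <;>
    refine ⟨by simp, ?_, ?_⟩ <;>
    simp only [posDepth_cons, posWeight_cons] <;>
    split_ifs <;> omega
  | last A a m =>
    refine absorb_mem_supported fun i _ hi => ⟨by simp, ?_, ?_⟩ <;>
    simp only [posDepth_cons, posWeight_cons, posDepth_append, posWeight_append] <;>
    split_ifs <;> omega
  | middle A a m b B =>
    refine Submodule.sub_mem _ (Submodule.sub_mem _
      (absorb_mem_supported fun i _ _ => ?_) (absorb_mem_supported fun i _ hi => ?_))
      (Finsupp.single_mem_supported ℚ _ ?_) <;>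
    refine ⟨by simp, ?_, ?_⟩ <;>
    simp only [posDepth_cons, posWeight_cons, posDepth_append, posWeight_append] <;>
    split_ifs <;> omega

theorem exists_recurrenceRHS {n : List ℤ} (h : ∃ a ∈ n, a ≤ 0) : ∃ c, RecurrenceRHS n c := by
  obtain ⟨x, hx, hx0⟩ := h
  obtain ⟨m, rfl⟩ : ∃ m : ℕ, x = -(m : ℤ) := ⟨x.natAbs, by omega⟩
  obtain ⟨A, B, rfl⟩ := List.append_of_mem hx
  rcases List.eq_nil_or_concat A with rfl | ⟨A, a, rfl⟩
  · rcases B with _ | ⟨b, B⟩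
    · exact ⟨_, RecurrenceRHS.single m⟩
    · exact ⟨_, RecurrenceRHS.first m b B⟩
  · rcases B with _ | ⟨b, B⟩
    · refine ⟨absorb (fun x => A ++ [x]) a m, ?_⟩
      simpa using RecurrenceRHS.last A a m
    · exact ⟨_, by simpa using RecurrenceRHS.middle A a m b B⟩

/-! ### Admissible indices and the reduction to multiple zeta values -/

theorem IsAdmissible.tail {a : ℤ} {l : List ℤ} (h : IsAdmissible (a :: l)) : IsAdmissible l := by
  refine ⟨fun b hb => h.1 b (by simp [hb]), fun b hb => ?_⟩
  cases l with
  | nil => simp at hb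
  | cons c l => exact h.2 b (by rwa [List.getLast?_cons_cons])

/-- All entries are at least `1` and the last is at least `2`. Applied to every tail, this is the
condition of absolute convergence. -/
theorem IsAdmissible.length_lt_sum {l : List ℤ} (h : IsAdmissible l) (hl : l ≠ []) :
    (l.length : ℤ) < l.sum := by
  induction l with
  | nil => exact absurd rfl hl
  | cons a l ih =>
    rcases l with _ | ⟨b, l⟩
    · simpa using h.2 a (by simp)
    · have h1 := ih h.tail (by simp)
      have h2 := h.1 a (by simp)
      rw [List.sum_cons, List.length_cons]
      push_cast
      linarith

theorem IsAdmissible.conv {l : List ℤ} (h : IsAdmissible l) : Conv 0 (castList l) := by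
  induction l with
  | nil => exact conv_nil 0
  | cons a l ih =>
    refine conv_cons.2 ⟨?_, ih h.tail⟩
    have h1 := h.length_lt_sum (by simp)
    have h2 : (l.map (Int.cast : ℤ → ℂ)).sum = ((l.sum : ℤ) : ℂ) := by
      simp
    rw [h2, List.length_map, Complex.intCast_re, Complex.intCast_re, add_zero]
    rw [List.sum_cons, List.length_cons] at h1
    exact_mod_cast h1

theorem IsAdmissible.valueAt_eq {F : (r : ℕ) → (Fin r → ℂ) → ℂ}
    (hF : ∀ r, IsMultipleZetaFunction r (F r)) {n : List ℤ} (h : IsAdmissible n) :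
    valueAt F n = (mzv n : ℂ) := by
  have h1 : toPoint n ∈ convergenceRegion n.length := by
    rw [mem_convergenceRegion_iff]
    have : List.ofFn (toPoint n) = castList n := by
      conv_rhs => rw [castList, ← List.ofFn_get n, List.map_ofFn]
      rfl
    rw [this]
    exact h.conv
  rw [valueAt, mzv, Complex.ofReal_tsum, ← ((hF n.length).2 _ h1).tsum_eq]
  refine tsum_congr fun x => ?_
  rw [Complex.ofReal_prod]
  refine Finset.prod_congr rfl fun i _ => ?_
  rw [toPoint, Complex.cpow_neg, Complex.cpow_intCast]
  push_cast
  rfl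

/-- A last entry `1` is itself a singularity, and this is the only obstruction to admissibility for
positive entries. -/
theorem isAdmissible_of_regular {n : List ℤ} (hn : IsRegularIndex n) (h : ∀ a ∈ n, 0 < a) :
    IsAdmissible n := by
  refine ⟨h, fun a ha => ?_⟩
  obtain ⟨A, rfl⟩ := List.getLast?_eq_some_iff.1 ha
  rw [isRegularIndex_iff, List.map_append, List.map_cons, List.map_nil] at hn
  have h1 : (a : ℂ) ≠ 1 := hn.last_ne_one
  have h2 : a ≠ 1 := fun h => h1 (by simp [h])
  have h3 := h a (by simp)
  omega

/-- The admissible indices with depth and weight bounded by those of the positive part of `n`. -/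
def boundedAdmissible (n : List ℤ) : Set (List ℤ) :=
  {m | IsAdmissible m ∧ m.length ≤ posDepth n ∧ m.sum ≤ posWeight n}

/-- Induction on the length: an index with a nonpositive entry is replaced by shorter regular ones,
and an index without one is admissible. -/
theorem exists_expands {F : (r : ℕ) → (Fin r → ℂ) → ℂ}
    (hF : ∀ r, IsMultipleZetaFunction r (F r)) (n : List ℤ) (hn : IsRegularIndex n) :
    ∃ c : List ℤ →₀ ℚ, Expands n c ∧ c ∈ Finsupp.supported ℚ ℚ (boundedAdmissible n) ∧
      valueAt F n = Finsupp.linearCombination ℚ (fun m => (mzv m : ℂ)) c := by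
  by_cases hpos : ∀ a ∈ n, 0 < a
  · have hadm := isAdmissible_of_regular hn hpos
    refine ⟨Finsupp.single n 1, Expands.refl n, Finsupp.single_mem_supported ℚ _ ⟨hadm, ?_, ?_⟩, ?_⟩
    · rw [posDepth, positivePart, List.filter_eq_self.2 (by simpa using hpos)]
    · rw [posWeight, positivePart, List.filter_eq_self.2 (by simpa using hpos)]
    · rw [hadm.valueAt_eq hF, Finsupp.linearCombination_single, one_smul]
  · push Not at hpos
    obtain ⟨c, hc⟩ := exists_recurrenceRHS hpos
    have hreg := hc.mem_supported_regular hn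
    have hsmall := hc.mem_supported_smaller
    rw [Finsupp.mem_supported] at hreg hsmall
    -- An expansion is attached to every list, with `0` outside the support, so that the choice
    -- yields a total function.
    have ih : ∀ k : List ℤ, ∃ e : List ℤ →₀ ℚ, k ∈ c.support → Expands k e ∧
        e ∈ Finsupp.supported ℚ ℚ (boundedAdmissible k) ∧
        valueAt F k = Finsupp.linearCombination ℚ (fun m => (mzv m : ℂ)) e := by
      intro k
      by_cases hk : k ∈ c.support
      · have hlt : k.length < n.length := (hsmall hk).1
        obtain ⟨e, he⟩ := exists_expands hF k (hreg hk)
        exact ⟨e, fun _ => he⟩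
      · exact ⟨0, fun h => absurd h hk⟩
    choose e he using ih
    refine ⟨c.sum fun k q => q • e k, Expands.step n c e hc fun k hk => (he k hk).1, ?_, ?_⟩
    · refine Submodule.sum_mem _ fun k hk => Submodule.smul_mem _ _ ?_
      refine Finsupp.supported_mono ?_ (he k hk).2.1
      rintro m ⟨h1, h2, h3⟩
      exact ⟨h1, h2.trans (hsmall hk).2.1, h3.trans (hsmall hk).2.2⟩
    · rw [hc.valueAt_eq hF hn, Finsupp.linearCombination_apply, Finsupp.sum, Finsupp.sum, map_sum]
      exact Finset.sum_congr rfl fun k hk => by rw [map_smul, (he k hk).2.2]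
termination_by n.length

end EulerZagier

end

/-! ### The theorem -/

open EulerZagier in
theorem theorem2p12 :
    -- the multiple zeta functions exist (holomorphic continuation off the singularities), and
    (∃ F : (r : ℕ) → (Fin r → ℂ) → ℂ, ∀ r, IsMultipleZetaFunction r (F r)) ∧
    ∀ F : (r : ℕ) → (Fin r → ℂ) → ℂ, (∀ r, IsMultipleZetaFunction r (F r)) →
      -- the recurrence relation holds at regular integer points and stays among them,
      (∀ (n : List ℤ) (c : List ℤ →₀ ℚ), IsRegularIndex n → RecurrenceRHS n c →
        (∀ k ∈ c.support, IsRegularIndex k) ∧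
        valueAt F n = c.sum fun k q => (q : ℂ) * valueAt F k) ∧
      ∀ n : List ℤ, IsRegularIndex n →
        -- it expresses the value as a rational linear combination of multiple zeta values,
        (∃ c : List ℤ →₀ ℚ, Expands n c ∧
          (∀ m ∈ c.support, IsAdmissible m ∧ m.length ≤ posDepth n ∧ m.sum ≤ posWeight n) ∧
          valueAt F n = ((c.sum fun m q => (q : ℝ) * mzv m : ℝ) : ℂ)) ∧
        -- so that the value lies in the span determined by the positive part of the index
        ∃ z ∈ mzvSpan (posDepth n) (posWeight n), valueAt F n = (z : ℂ) := by
  refine ⟨⟨multipleZeta, isMultipleZetaFunction_multipleZeta⟩,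
    fun F hF => ⟨fun n c hn hc => ⟨?_, ?_⟩,
    fun n hn => ?_⟩⟩
  · intro k hk
    exact (Finsupp.mem_supported ℚ c).1 (hc.mem_supported_regular hn) hk
  · rw [sum_mul_eq_linearCombination, hc.valueAt_eq hF hn]
  · obtain ⟨c, h1, h2, h3⟩ := exists_expands hF n hn
    have hsupp : ∀ m ∈ c.support, IsAdmissible m ∧ m.length ≤ posDepth n ∧ m.sum ≤ posWeight n :=
      fun m hm => (Finsupp.mem_supported ℚ c).1 h2 hm
    have hval : valueAt F n = ((c.sum fun m q => (q : ℝ) * mzv m : ℝ) : ℂ) := by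
      rw [h3, ← sum_mul_eq_linearCombination, Finsupp.sum, Finsupp.sum]
      push_cast
      rfl
    refine ⟨⟨c, h1, hsupp, hval⟩, _, ?_, hval⟩
    refine Submodule.sum_mem _ fun m hm => ?_
    simp only [← Rat.smul_def]
    obtain ⟨ha, hd, hw⟩ := hsupp m hm
    exact Submodule.smul_mem _ _ (Submodule.subset_span ⟨m, ha, hd, hw, rfl⟩)
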